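/- **Setting.** Let $\lambda\in\mathbb R$ with $\lambda\neq 0$, $\lambda^2\neq 1$. The unit fuzzy sphere $\mathbb C_\lambda[S^2]$ is the unital $*$-algebra over $\mathbb C$ with self-adjoint generators $y^1,y^2,y^3$ and relations $[y^i,y^j]=2\imath\lambda\,\epsilon_{ijk}y^k$, $\sum_i (y^i)^2=1-\lambda^2$. Its differential calculus is free over central self-adjoint anticommuting 1-forms $s^1,s^2,s^3$, with ${\rm d}f=(\partial_i f)s^i$, $\partial_i=\frac1{2\imath\lambda}[y^i,\cdot\,]$ and ${\rm d}s^i=-\frac12\epsilon_{ijk}s^j\wedge s^k$. Let $M$ be a smooth manifold (finite-dimensional, Hausdorff, second countable), and give $A=C^\infty(M)\otimes\mathbb C_\lambda[S^2]$ the graded tensor product $(\Omega,{\rm d})$ of the classical calculus of $M$ and that of $\mathbb C_\lambda[S^2]$. Repeated indices are summed. Let $$\mathfrak g=g_{\mu\nu}\,{\rm d}x^\mu\otimes{\rm d}x^\nu+A_{\mu i}({\rm d}x^\mu\otimes s^i+s^i\otimes{\rm d}x^\mu)+h_{ij}\,s^i\otimes s^j\ \in\ \Omega^1\otimes_A\Omega^1,$$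 where $g$ is a real symmetric 2-tensor on $M$, $A_i=A_{\mu i}{\rm d}x^\mu$ are real 1-forms on $M$, and $h_{ij}=h_{ji}$ are real smooth functions on $M$. Suppose that $\mathfrak g$ is a quantum metric: $\wedge(\mathfrak g)=0$ and there is a bimodule map $(\ ,\ ):\Omega^1\otimes_A\Omega^1\to A$ with $((\omega,\ )\otimes{\rm id})\mathfrak g=\omega=({\rm id}\otimes(\ ,\omega))\mathfrak g$ for all $\omega\in\Omega^1$. A bimodule connection is an additive map $\nabla:\Omega^1\to\Omega^1\otimes_A\Omega^1$ with a bimodule map $\sigma:\Omega^1\otimes_A\Omega^1\to\Omega^1\otimes_A\Omega^1$ such that $\nabla(a\omega)=a\nabla\omega+{\rm d}a\otimes\omega$ and $\nabla(\omega a)=(\nabla\omega)a+\sigma(\omega\otimes{\rm d}a)$. It is torsion free if $\wedge\nabla={\rm d}$ on $\Omega^1$, and metric compatible if $(\nabla\otimes{\rm id}+(\sigma\otimes{\rm id})({\rm id}\otimes\nabla))\mathfrak g=0$; it is a quantum Levi-Civita connection (QLC) if it is both. **Theorem.** There is exactly one QLC for $\mathfrak g$ whose generalised braiding $\sigma$ is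 the flip on the basis $\{{\rm d}x^\mu,s^i\}$ (that is, $\sigma(\omega\otimes\eta)=\eta\otimes\omega$ whenever each of $\omega,\eta$ is a real 1-form on $M$ or one of the $s^i$). It is $*$-preserving: $\nabla\circ *=\sigma\circ\dagger\circ\nabla$ with $\dagger={\rm flip}(*\otimes*)$. Moreover, suppose that the matrix $h=(h_{ij})$ is invertible on $M$, with inverse $(h^{ij})$. Then the effective metric $\tilde g_{\mu\nu}=g_{\mu\nu}-h^{ij}A_{i\mu}A_{j\nu}$ (where $A_{i\mu}=A_{\mu i}$) is invertible, with inverse $\tilde g^{\mu\nu}$, and in any local coordinates $x^\mu$ of $M$ this QLC has the form $$\nabla{\rm d}x^\mu=-\Gamma^\mu_{\alpha\beta}{\rm d}x^\alpha\otimes{\rm d}x^\beta+F^\mu_{\alpha i}({\rm d}x^\alpha\otimes s^i+s^i\otimes{\rm d}x^\alpha)+D^\mu_{ij}s^i\otimes s^j,$$ $$\nabla s^k=E^k_{\alpha\beta}{\rm d}x^\alpha\otimes{\rm d}x^\beta+B^k_{\alpha i}({\rm d}x^\alpha\otimes s^i+s^i\otimes{\rm d}x^\alpha)+H^k_{ij}s^i\otimes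 s^j$$ with real coefficients depending only on $M$. Write $X_{[\alpha}Y_{\beta]}=X_\alpha Y_\beta-X_\beta Y_\alpha$ and $X_{(\alpha}Y_{\beta)}=X_\alpha Y_\beta+X_\beta Y_\alpha$, without factors, and let $\tilde\Gamma$ be the Christoffel symbols of $\tilde g$. Then $$\Gamma^\sigma_{\mu\nu}=\tilde\Gamma^\sigma_{\mu\nu}+\tfrac12\tilde g^{\sigma\rho}\big(A_{\mu i}\partial_{[\nu}(A_{\rho]j}h^{ij})+A_{\nu i}\partial_{[\mu}(A_{\rho]j}h^{ij})+A_{i\mu}A_{j\nu}\partial_\rho h^{ij}\big),$$ $$E^k_{\alpha\beta}=-\tfrac12h^{ki}\nabla_{(\alpha}A_{\beta)i},\qquad \nabla_\alpha A_{\beta i}=\partial_\alpha A_{\beta i}-\Gamma^\mu_{\alpha\beta}A_{\mu i},$$ $$F^\mu_{\alpha i}=\tfrac12\tilde g^{\beta\mu}\big(-\partial_{[\alpha}A_{\beta]i}+h^{jk}A_{k\beta}(\partial_\alpha h_{ij}-A_{\alpha l}\epsilon_{ijl})\big),$$ $$D^\mu_{ij}=\tfrac12\tilde g^{\mu\alpha}\big(\partial_\alpha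 h_{ij}-A_{k\alpha}h^{mk}h_{n(i}\epsilon_{j)mn}\big),$$ and, at the points where $(g_{\mu\nu})$ is also invertible, with inverse $g^{\mu\nu}$, the matrix $\tilde h_{ij}=h_{ij}-g^{\mu\nu}A_{i\mu}A_{j\nu}$ is invertible and, with $\tilde h^{ij}$ its inverse, $$B^k_{\alpha i}=\tfrac12\tilde h^{jk}\big(g^{\mu\beta}A_{j\mu}\partial_{[\alpha}A_{\beta]i}+A_{l\alpha}\epsilon_{ijl}-\partial_\alpha h_{ij}\big),$$ $$H^l_{ik}=\tfrac12\tilde h^{jl}\big(h_{n(i}\epsilon_{k)jn}-A_{j\mu}g^{\mu\alpha}\partial_\alpha h_{ik}\big)-\tfrac12\epsilon_{lik}.$$ -/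

import Mathlib

open scoped TensorProduct
open MulOpposite

noncomputable section

/-! ## Bimodules and the tensor product over a noncommutative ring

Right modules over `A` are modules over `Aᵐᵒᵖ`; `op a • m` is `m a`. -/

namespace QRG

section Balanced

variable (A : Type*) [Ring A]
variable (M : Type*) [AddCommGroup M] [Module Aᵐᵒᵖ M]
variable (N : Type*) [AddCommGroup N] [Module A N]

/-- The relations `m a ⊗ n = m ⊗ a n`. -/
def balancedRel : AddSubgroup (M ⊗[ℤ] N) :=
  AddSubgroup.closure
    {t | ∃ (m : M) (a : A) (n : N), t = (op a • m) ⊗ₜ[ℤ] n - m ⊗ₜ[ℤ] (a • n)}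

/-- The tensor product `M ⊗_A N` of a right `A`-module and a left `A`-module. -/
def BTensor : Type _ := (M ⊗[ℤ] N) ⧸ balancedRel A M N

instance : AddCommGroup (BTensor A M N) :=
  inferInstanceAs (AddCommGroup ((M ⊗[ℤ] N) ⧸ balancedRel A M N))

/-- The quotient map to `M ⊗_A N`. -/
def BTensor.mk : M ⊗[ℤ] N →+ BTensor A M N := QuotientAddGroup.mk' (balancedRel A M N)

variable {M N}

/-- The elementary tensor `m ⊗ n` in `M ⊗_A N`. -/
def tmul (m : M) (n : N) : BTensor A M N := BTensor.mk A M N (m ⊗ₜ[ℤ] n)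

variable {A}

theorem tmul_balanced (m : M) (a : A) (n : N) :
    tmul A (op a • m) n = tmul A m (a • n) := by
  refine (QuotientAddGroup.eq_iff_sub_mem).2 (AddSubgroup.subset_closure ⟨m, a, n, rfl⟩)

theorem tmul_add (m : M) (n n' : N) : tmul A m (n + n') = tmul A m n + tmul A m n' := by
  simp only [tmul, TensorProduct.tmul_add, map_add]

theorem add_tmul (m m' : M) (n : N) : tmul A (m + m') n = tmul A m n + tmul A m' n := by
  simp only [tmul, TensorProduct.add_tmul, map_add]

/-- `m ⊗ n` as a biadditive map. -/
def tmulHom : M →+ N →+ BTensor A M N :=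
  AddMonoidHom.mk' (fun m => AddMonoidHom.mk' (fun n => tmul A m n) (tmul_add m))
    (fun m m' => AddMonoidHom.ext fun n => add_tmul m m' n)

@[simp] theorem tmulHom_apply (m : M) (n : N) : tmulHom (A := A) m n = tmul A m n := rfl

variable {P : Type*} [AddCommGroup P]

/-- The universal property of `M ⊗_A N`. -/
def BTensor.lift (f : M →+ N →+ P) (hf : ∀ (m : M) (a : A) (n : N), f (op a • m) n = f m (a • n)) :
    BTensor A M N →+ P :=
  QuotientAddGroup.lift (balancedRel A M N)
    (TensorProduct.liftAddHom f (fun r m n => by simp))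
    ((AddSubgroup.closure_le _).2 (by
      rintro t ⟨m, a, n, rfl⟩
      simp only [SetLike.mem_coe, AddMonoidHom.mem_ker, map_sub]
      rw [TensorProduct.liftAddHom_tmul, TensorProduct.liftAddHom_tmul, hf, sub_self]))

@[simp] theorem BTensor.lift_tmul (f : M →+ N →+ P)
    (hf : ∀ (m : M) (a : A) (n : N), f (op a • m) n = f m (a • n)) (m : M) (n : N) :
    BTensor.lift f hf (tmul A m n) = f m n := rfl

theorem BTensor.hom_ext {f g : BTensor A M N →+ P}
    (h : ∀ m n, f (tmul A m n) = g (tmul A m n)) : f = g := by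
  ext t
  obtain ⟨t, rfl⟩ : ∃ t', BTensor.mk A M N t' = t :=
    QuotientAddGroup.mk'_surjective (balancedRel A M N) t
  induction t using TensorProduct.induction_on with
  | zero => simp
  | tmul m n => exact h m n
  | add x y hx hy =>
    have := congrArg₂ (· + ·) hx hy
    simpa only [map_add] using this

section LeftAction

variable [Module A M] [SMulCommClass A Aᵐᵒᵖ M]

/-- Left multiplication by `a` on `M ⊗_A N`. -/
def BTensor.leftMul (a : A) : BTensor A M N →+ BTensor A M N :=
  BTensor.lift (tmulHom.comp (DistribSMul.toAddMonoidHom M a)) (fun m b n => by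
    change tmul A (a • op b • m) n = tmul A (a • m) (b • n)
    rw [smul_comm, tmul_balanced])

instance : SMul A (BTensor A M N) := ⟨fun a t => BTensor.leftMul a t⟩

theorem BTensor.smul_tmul (a : A) (m : M) (n : N) :
    a • tmul A m n = tmul A (a • m) n := rfl

instance : Module A (BTensor A M N) where
  one_smul t := DFunLike.congr_fun (f := BTensor.leftMul (1 : A)) (g := AddMonoidHom.id _)
    (BTensor.hom_ext fun m n => by
      change tmul A ((1 : A) • m) n = tmul A m n
      rw [one_smul]) t
  mul_smul a b t := DFunLike.congr_fun (f := BTensor.leftMul (a * b))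
    (g := (BTensor.leftMul a).comp (BTensor.leftMul b))
    (BTensor.hom_ext fun m n => by
      change tmul A ((a * b) • m) n = tmul A (a • b • m) n
      rw [mul_smul]) t
  smul_zero a := map_zero (BTensor.leftMul a)
  smul_add a := map_add (BTensor.leftMul a)
  add_smul a b t := DFunLike.congr_fun (f := BTensor.leftMul (a + b))
    (g := BTensor.leftMul a + BTensor.leftMul b)
    (BTensor.hom_ext fun m n => by
      change tmul A ((a + b) • m) n = tmul A (a • m) n + tmul A (b • m) n
      rw [add_smul, add_tmul]) t
  zero_smul t := DFunLike.congr_fun (f := BTensor.leftMul (0 : A)) (g := 0)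
    (BTensor.hom_ext fun m n => by
      change tmul A ((0 : A) • m) n = 0
      rw [zero_smul, ← tmulHom_apply, map_zero, AddMonoidHom.zero_apply]) t

end LeftAction

section RightAction

variable [Module Aᵐᵒᵖ N] [SMulCommClass A Aᵐᵒᵖ N]

/-- Right multiplication by `a` on `M ⊗_A N`. -/
def BTensor.rightMul (a : Aᵐᵒᵖ) : BTensor A M N →+ BTensor A M N :=
  BTensor.lift (AddMonoidHom.mk' (fun m => (tmulHom m).comp (DistribSMul.toAddMonoidHom N a))
    (fun m m' => by ext n; exact add_tmul m m' (a • n))) (fun m b n => by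
    change tmul A (op b • m) (a • n) = tmul A m (a • b • n)
    rw [tmul_balanced, smul_comm])

instance : SMul Aᵐᵒᵖ (BTensor A M N) := ⟨fun a t => BTensor.rightMul a t⟩

theorem BTensor.op_smul_tmul (a : Aᵐᵒᵖ) (m : M) (n : N) :
    a • tmul A m n = tmul A m (a • n) := rfl

instance : Module Aᵐᵒᵖ (BTensor A M N) where
  one_smul t := DFunLike.congr_fun (f := BTensor.rightMul (1 : Aᵐᵒᵖ)) (g := AddMonoidHom.id _)
    (BTensor.hom_ext fun m n => by
      change tmul A m ((1 : Aᵐᵒᵖ) • n) = tmul A m n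
      rw [one_smul]) t
  mul_smul a b t := DFunLike.congr_fun (f := BTensor.rightMul (a * b))
    (g := (BTensor.rightMul a).comp (BTensor.rightMul b))
    (BTensor.hom_ext fun m n => by
      change tmul A m ((a * b) • n) = tmul A m (a • b • n)
      rw [mul_smul]) t
  smul_zero a := map_zero (BTensor.rightMul a)
  smul_add a := map_add (BTensor.rightMul a)
  add_smul a b t := DFunLike.congr_fun (f := BTensor.rightMul (a + b))
    (g := BTensor.rightMul a + BTensor.rightMul b)
    (BTensor.hom_ext fun m n => by
      change tmul A m ((a + b) • n) = tmul A m (a • n) + tmul A m (b • n)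
      rw [add_smul, tmul_add]) t
  zero_smul t := DFunLike.congr_fun (f := BTensor.rightMul (0 : Aᵐᵒᵖ)) (g := 0)
    (BTensor.hom_ext fun m n => by
      change tmul A m ((0 : Aᵐᵒᵖ) • n) = 0
      rw [zero_smul, ← tmulHom_apply, map_zero]) t

end RightAction

instance [Module A M] [SMulCommClass A Aᵐᵒᵖ M] [Module Aᵐᵒᵖ N] [SMulCommClass A Aᵐᵒᵖ N] :
    SMulCommClass A Aᵐᵒᵖ (BTensor A M N) where
  smul_comm a b t := DFunLike.congr_fun (f := (BTensor.leftMul a).comp (BTensor.rightMul b))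
    (g := (BTensor.rightMul b).comp (BTensor.leftMul a)) (BTensor.hom_ext fun m n => by
      change a • b • tmul A m n = b • a • tmul A m n
      simp only [BTensor.smul_tmul, BTensor.op_smul_tmul]) t

end Balanced

/-! ## Quantum metrics and bimodule connections

`Ω` is the bimodule of 1-forms over `A`, with differential `d : A → Ω`. -/

/-- A map of `A`-bimodules. -/
def IsBimoduleMap (A : Type*) [Ring A] {P Q : Type*} [AddCommGroup P] [Module A P] [Module Aᵐᵒᵖ P]
    [AddCommGroup Q] [Module A Q] [Module Aᵐᵒᵖ Q] (f : P →+ Q) : Prop :=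
  (∀ (a : A) (t : P), f (a • t) = a • f t) ∧ ∀ (a : A) (t : P), f (op a • t) = op a • f t

section Connection

variable {A : Type*} [Ring A]
variable {Ω : Type*} [AddCommGroup Ω] [Module A Ω] [Module Aᵐᵒᵖ Ω] [SMulCommClass A Aᵐᵒᵖ Ω]

/-- `((ω, ) ⊗ id)`, that is, `α ⊗ β ↦ (ω, α) β`. -/
def contractLeft (p : BTensor A Ω Ω →+ A) (hp : IsBimoduleMap A p) (ω : Ω) :
    BTensor A Ω Ω →+ Ω :=
  BTensor.lift
    (AddMonoidHom.mk' (fun α => DistribSMul.toAddMonoidHom Ω (p (tmul A ω α)))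
      (fun α α' => by
        ext β
        simp [tmul_add, add_smul]))
    (fun α a β => by
      change p (tmul A ω (op a • α)) • β = p (tmul A ω α) • a • β
      rw [← BTensor.op_smul_tmul, hp.2, op_smul_eq_mul, mul_smul])

/-- `(id ⊗ ( ,ω))`, that is, `α ⊗ β ↦ α (β, ω)`. -/
def contractRight (p : BTensor A Ω Ω →+ A) (hp : IsBimoduleMap A p) (ω : Ω) :
    BTensor A Ω Ω →+ Ω :=
  BTensor.lift
    (AddMonoidHom.mk' (fun α => AddMonoidHom.mk' (fun β => op (p (tmul A β ω)) • α)
      (fun β β' => by rw [add_tmul, map_add, op_add, add_smul]))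
      (fun α α' => by
        ext β
        simp))
    (fun α a β => by
      change op (p (tmul A β ω)) • op a • α = op (p (tmul A (a • β) ω)) • α
      rw [← BTensor.smul_tmul, hp.1, smul_eq_mul, op_mul, mul_smul])

/-- The bimodule map `p = ( , )` is inverse to `𝔤`:
`((ω, ) ⊗ id) 𝔤 = ω = (id ⊗ ( ,ω)) 𝔤` for all 1-forms `ω`. -/
def IsMetricInverse (𝔤 : BTensor A Ω Ω) (p : BTensor A Ω Ω →+ A) : Prop :=
  ∃ hp : IsBimoduleMap A p, ∀ ω : Ω, contractLeft p hp ω 𝔤 = ω ∧ contractRight p hp ω 𝔤 = ω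

/-- A quantum metric: an element of `Ω ⊗_A Ω` that has an inverse bimodule map `( , )` and is
quantum symmetric, `∧ 𝔤 = 0`. -/
def IsQuantumMetric {Ω2 : Type*} [AddCommGroup Ω2] (wedge : BTensor A Ω Ω →+ Ω2)
    (𝔤 : BTensor A Ω Ω) : Prop :=
  (∃ p : BTensor A Ω Ω →+ A, IsMetricInverse 𝔤 p) ∧ wedge 𝔤 = 0

/-- A (left) bimodule connection on `Ω` with its generalised braiding `σ`. -/
structure BimoduleConnection (d : A →+ Ω) where
  /-- The connection `∇ : Ω → Ω ⊗_A Ω`. -/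
  nabla : Ω →+ BTensor A Ω Ω
  /-- The generalised braiding `σ : Ω ⊗_A Ω → Ω ⊗_A Ω`. -/
  sigma : BTensor A Ω Ω →+ BTensor A Ω Ω
  sigma_bimodule : IsBimoduleMap A sigma
  leibniz_left : ∀ (a : A) (ω : Ω), nabla (a • ω) = a • nabla ω + tmul A (d a) ω
  leibniz_right : ∀ (a : A) (ω : Ω), nabla (op a • ω) = op a • nabla ω + sigma (tmul A ω (d a))

namespace BimoduleConnection

variable {d : A →+ Ω} (D : BimoduleConnection d)

/-- `(σ ⊗ id)(ω ⊗ t)` for `t ∈ Ω ⊗_A Ω`, that is, `α ⊗ β ↦ σ(ω ⊗ α) ⊗ β`. -/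
def sigmaAct (ω : Ω) : BTensor A Ω Ω →+ BTensor A (BTensor A Ω Ω) Ω :=
  BTensor.lift
    (AddMonoidHom.mk' (fun α => tmulHom (D.sigma (tmul A ω α)))
      (fun α α' => by rw [tmul_add, map_add, map_add]))
    (fun α a β => by
      change tmul A (D.sigma (tmul A ω (op a • α))) β = tmul A (D.sigma (tmul A ω α)) (a • β)
      rw [← BTensor.op_smul_tmul, D.sigma_bimodule.2, tmul_balanced])

theorem sigmaAct_add (ω ω' : Ω) : D.sigmaAct (ω + ω') = D.sigmaAct ω + D.sigmaAct ω' :=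
  BTensor.hom_ext fun α β => by
    change tmul A (D.sigma (tmul A (ω + ω') α)) β
      = tmul A (D.sigma (tmul A ω α)) β + tmul A (D.sigma (tmul A ω' α)) β
    rw [add_tmul, map_add, add_tmul]

theorem sigmaAct_smul (ω : Ω) (a : A) (t : BTensor A Ω Ω) :
    D.sigmaAct (op a • ω) t = D.sigmaAct ω (a • t) :=
  DFunLike.congr_fun (f := D.sigmaAct (op a • ω))
    (g := (D.sigmaAct ω).comp (BTensor.leftMul a)) (BTensor.hom_ext fun α β => by
      change tmul A (D.sigma (tmul A (op a • ω) α)) β = tmul A (D.sigma (tmul A ω (a • α))) β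
      rw [tmul_balanced]) t

/-- The action of the connection on 2-tensors,
`∇(ω ⊗ η) = ∇ω ⊗ η + (σ ⊗ id)(ω ⊗ ∇η)`. -/
def nablaTensor : BTensor A Ω Ω →+ BTensor A (BTensor A Ω Ω) Ω :=
  BTensor.lift
    (AddMonoidHom.mk' (fun ω => tmulHom (D.nabla ω) + (D.sigmaAct ω).comp D.nabla)
      (fun ω ω' => by
        ext η
        simp only [map_add, sigmaAct_add, AddMonoidHom.add_apply, AddMonoidHom.comp_apply]
        abel))
    (fun ω a η => by
      change tmul A (D.nabla (op a • ω)) η + D.sigmaAct (op a • ω) (D.nabla η)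
        = tmul A (D.nabla ω) (a • η) + D.sigmaAct ω (D.nabla (a • η))
      rw [D.leibniz_right, D.leibniz_left, map_add, add_tmul, tmul_balanced, sigmaAct_smul]
      change _ = _ + (_ + tmul A (D.sigma (tmul A ω (d a))) η)
      abel)

/-- Metric compatibility, `∇𝔤 = 0`. -/
def IsMetricCompatible (𝔤 : BTensor A Ω Ω) : Prop := D.nablaTensor 𝔤 = 0

/-- Vanishing torsion, `∧∇ - d = 0`. -/
def IsTorsionFree {Ω2 : Type*} [AddCommGroup Ω2] (wedge : BTensor A Ω Ω →+ Ω2) (d₁ : Ω →+ Ω2) :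
    Prop := ∀ ω : Ω, wedge (D.nabla ω) - d₁ ω = 0

/-- A quantum Levi-Civita connection. -/
def IsQLC {Ω2 : Type*} [AddCommGroup Ω2] (wedge : BTensor A Ω Ω →+ Ω2) (d₁ : Ω →+ Ω2)
    (𝔤 : BTensor A Ω Ω) : Prop := D.IsTorsionFree wedge d₁ ∧ D.IsMetricCompatible 𝔤

end BimoduleConnection

/-- The operation `† = flip (* ⊗ *)` on `Ω ⊗_A Ω`, where `starA` and `starΩ` are the
`*`-operations of `A` and of `Ω`. -/
def dagger (starA : A →+ A) (starΩ : Ω →+ Ω)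
    (h₁ : ∀ (a : A) (ω : Ω), starΩ (a • ω) = op (starA a) • starΩ ω)
    (h₂ : ∀ (a : A) (ω : Ω), starΩ (op a • ω) = starA a • starΩ ω) :
    BTensor A Ω Ω →+ BTensor A Ω Ω :=
  BTensor.lift
    (AddMonoidHom.mk' (fun ω => (tmulHom.flip (starΩ ω)).comp starΩ)
      (fun ω ω' => by rw [map_add, map_add]; rfl))
    (fun ω a η => by
      change tmul A (starΩ η) (starΩ (op a • ω)) = tmul A (starΩ (a • η)) (starΩ ω)
      rw [h₁, h₂, tmul_balanced])

end Connection

/-! ## The fuzzy sphere -/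

/-- The totally antisymmetric symbol `ε_{ijk}` with `ε_{123} = 1`. -/
def eps (i j k : Fin 3) : ℤ :=
  ((j : ℤ) - (i : ℤ)) * ((k : ℤ) - (i : ℤ)) * ((k : ℤ) - (j : ℤ)) / 2

/-- The relations `[y^i, y^j] = 2 i λ ε_{ijk} y^k` and `∑ (y^i)² = 1 - λ²`. -/
inductive FuzzyRel (lam : ℝ) : FreeAlgebra ℂ (Fin 3) → FreeAlgebra ℂ (Fin 3) → Prop
  | comm (i j : Fin 3) : FuzzyRel lam
      (FreeAlgebra.ι ℂ i * FreeAlgebra.ι ℂ j - FreeAlgebra.ι ℂ j * FreeAlgebra.ι ℂ i)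
      (∑ k, (2 * Complex.I * (lam : ℂ) * (eps i j k : ℂ)) • FreeAlgebra.ι ℂ k)
  | casimir : FuzzyRel lam
      (∑ i, FreeAlgebra.ι ℂ i * FreeAlgebra.ι ℂ i)
      (algebraMap ℂ (FreeAlgebra ℂ (Fin 3)) (1 - (lam : ℂ) ^ 2))

/-- The unit fuzzy sphere `ℂ_λ[S²]`. -/
def FuzzySphere (lam : ℝ) : Type := RingQuot (FuzzyRel lam)

instance (lam : ℝ) : Ring (FuzzySphere lam) := inferInstanceAs (Ring (RingQuot (FuzzyRel lam)))

instance (lam : ℝ) : Algebra ℂ (FuzzySphere lam) :=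
  inferInstanceAs (Algebra ℂ (RingQuot (FuzzyRel lam)))

instance (lam : ℝ) : Module ℝ (FuzzySphere lam) := Algebra.toModule

namespace FuzzySphere

variable (lam : ℝ)

/-- The quotient map from the free algebra. -/
def mk : FreeAlgebra ℂ (Fin 3) →ₐ[ℂ] FuzzySphere lam := RingQuot.mkAlgHom ℂ (FuzzyRel lam)

/-- The generators `y^i`. -/
def y (i : Fin 3) : FuzzySphere lam := mk lam (FreeAlgebra.ι ℂ i)

theorem y_comm (i j : Fin 3) : y lam i * y lam j - y lam j * y lam i
    = ∑ k, (2 * Complex.I * (lam : ℂ) * (eps i j k : ℂ)) • y lam k := by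
  have h : mk lam _ = mk lam _ := RingQuot.mkAlgHom_rel ℂ (FuzzyRel.comm (lam := lam) i j)
  simp only [map_sub, map_mul, map_sum, map_smul] at h
  exact h

theorem y_casimir : ∑ i, y lam i * y lam i
    = algebraMap ℂ (FuzzySphere lam) (1 - (lam : ℂ) ^ 2) := by
  have h : mk lam _ = mk lam _ := RingQuot.mkAlgHom_rel ℂ (FuzzyRel.casimir (lam := lam))
  simp only [map_mul, map_sum, AlgHom.commutes] at h
  exact h

/-- The derivations `∂_i = (1 / 2iλ) [y^i, · ]`. -/
def del (i : Fin 3) : FuzzySphere lam →ₗ[ℝ] FuzzySphere lam :=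
  (1 / (2 * Complex.I * (lam : ℂ))) •
    (LinearMap.mulLeft ℝ (y lam i) - LinearMap.mulRight ℝ (y lam i))

/-- The opposite algebra with conjugate scalars; algebra maps into it are antilinear
antihomomorphisms. -/
def ConjOp : Type := (FuzzySphere lam)ᵐᵒᵖ

instance : Ring (ConjOp lam) := inferInstanceAs (Ring (FuzzySphere lam)ᵐᵒᵖ)

instance : Algebra ℂ (ConjOp lam) :=
  RingHom.toAlgebra' ((algebraMap ℂ (FuzzySphere lam)ᵐᵒᵖ).comp (starRingEnd ℂ))
    (fun c x => Algebra.commutes (A := (FuzzySphere lam)ᵐᵒᵖ) (starRingEnd ℂ c) x)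

/-- An element of the fuzzy sphere, in the conjugate opposite algebra. -/
def toConjOp (x : FuzzySphere lam) : ConjOp lam := (op x : (FuzzySphere lam)ᵐᵒᵖ)

/-- The inverse of `toConjOp`. -/
def ofConjOp (x : ConjOp lam) : FuzzySphere lam := unop (α := FuzzySphere lam) x

theorem conjOp_algebraMap (c : ℂ) : algebraMap ℂ (ConjOp lam) c
    = toConjOp lam (algebraMap ℂ (FuzzySphere lam) (starRingEnd ℂ c)) := rfl

theorem conjOp_mul (x x' : FuzzySphere lam) :
    toConjOp lam x * toConjOp lam x' = toConjOp lam (x' * x) := rfl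

theorem conjOp_sub (x x' : FuzzySphere lam) :
    toConjOp lam x - toConjOp lam x' = toConjOp lam (x - x') := rfl

theorem conjOp_sum (x : Fin 3 → FuzzySphere lam) :
    ∑ i, toConjOp lam (x i) = toConjOp lam (∑ i, x i) := by
  simp only [Fin.sum_univ_three]
  rfl

theorem conjOp_smul (c : ℂ) (x : FuzzySphere lam) :
    c • toConjOp lam x = toConjOp lam (starRingEnd ℂ c • x) := by
  rw [Algebra.smul_def, conjOp_algebraMap, conjOp_mul, Algebra.smul_def, Algebra.commutes]

/-- The `*`-operation as an algebra map to the conjugate opposite algebra. -/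
def starHom : FuzzySphere lam →ₐ[ℂ] ConjOp lam :=
  RingQuot.liftAlgHom ℂ ⟨FreeAlgebra.lift ℂ (fun i => toConjOp lam (y lam i)), by
    rintro _ _ (⟨i, j⟩ | _)
    · have hε : ∀ i j k, eps j i k = - eps i j k := by decide
      simp only [map_sub, map_mul, map_sum, map_smul]
      simp only [FreeAlgebra.lift_ι_apply, conjOp_smul, conjOp_mul, conjOp_sub, conjOp_sum]
      rw [y_comm]
      refine congrArg (toConjOp lam) (Finset.sum_congr rfl fun k _ => ?_)
      rw [hε i j k]
      have h2 : starRingEnd ℂ 2 = 2 := map_ofNat _ 2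
      simp [h2]
    · simp only [map_mul, map_sum, AlgHom.commutes]
      simp only [FreeAlgebra.lift_ι_apply, conjOp_mul, conjOp_sum, conjOp_algebraMap]
      rw [y_casimir]
      simp⟩

/-- The `*`-operation of the fuzzy sphere: the antilinear antihomomorphism with
`(y^i)^* = y^i`. -/
def star : FuzzySphere lam →ₗ[ℝ] FuzzySphere lam where
  toFun a := ofConjOp lam (starHom lam a)
  map_add' a b := by rw [map_add]; rfl
  map_smul' r a := by
    have h : ∀ b : FuzzySphere lam, r • b = (r : ℂ) • b :=
      fun b => (algebraMap_smul ℂ r b).symm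
    rw [h, map_smul, RingHom.id_apply, h]
    have h' := conjOp_smul lam (r : ℂ) (ofConjOp lam (starHom lam a))
    rw [Complex.conj_ofReal] at h'
    exact congrArg (ofConjOp lam) h'

theorem star_y (i : Fin 3) : star lam (y lam i) = y lam i := by
  have h : starHom lam (y lam i)
      = FreeAlgebra.lift ℂ (fun i => toConjOp lam (y lam i)) (FreeAlgebra.ι ℂ i) :=
    RingQuot.liftAlgHom_mkAlgHom_apply ℂ _ _ _
  rw [FreeAlgebra.lift_ι_apply] at h
  exact congrArg (ofConjOp lam) h

theorem star_smul (c : ℂ) (a : FuzzySphere lam) :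
    star lam (c • a) = starRingEnd ℂ c • star lam a := by
  change ofConjOp lam (starHom lam (c • a)) = _
  rw [map_smul]
  exact congrArg (ofConjOp lam) (conjOp_smul lam c (ofConjOp lam (starHom lam a)))

theorem star_mul (a b : FuzzySphere lam) : star lam (a * b) = star lam b * star lam a := by
  change ofConjOp lam (starHom lam (a * b)) = _
  rw [map_mul]
  rfl

end FuzzySphere

/-! ## The product calculus

`R` plays the role of the algebra `C^∞(M)` of real smooth functions on `M`, with vector fields the
derivations of `R` and 1-forms on `M` their `R`-linear dual. As `ℂ_λ[S²]` is a complex algebra,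
`R ⊗_ℝ ℂ_λ[S²]` is the tensor product over `ℂ` of complex smooth functions with `ℂ_λ[S²]`. -/

section Product

variable (R : Type*) [CommRing R] [Algebra ℝ R] (lam : ℝ)

/-- The product algebra `C^∞(M) ⊗ ℂ_λ[S²]`. -/
abbrev ProdAlg : Type _ := R ⊗[ℝ] FuzzySphere lam

/-- Vector fields on `M`. -/
abbrev VecField : Type _ := Derivation ℝ R R

/-- Real 1-forms on `M`. -/
abbrev OneForm : Type _ := Module.Dual R (VecField R)

/-- The `R`-module spanned by the derivations along `M` and by the three derivations `∂_i` of the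
fuzzy sphere. A pair `(X, ξ)` stands for `X + ξ^i ∂_i`. -/
abbrev ProdVec : Type _ := VecField R × (Fin 3 → R)

/-- The 1-forms of the product calculus, `Ω¹ = Ω¹(M) ⊗ ℂ_λ[S²] ⊕ (C^∞(M) ⊗ ℂ_λ[S²]) s^i`, realised
as `R`-linear maps on `ProdVec R` with values in the product algebra. Both actions of
the algebra are on the values, so that the real 1-forms on `M` and the `s^i` are central. -/
abbrev ProdForm : Type _ := ProdVec R →ₗ[R] ProdAlg R lam

/-- The 2-forms of the product calculus, as alternating `R`-bilinear maps. -/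
def prodForm2 : AddSubgroup (ProdVec R →ₗ[R] ProdVec R →ₗ[R] ProdAlg R lam) where
  carrier := {B | ∀ v, B v v = 0}
  zero_mem' v := rfl
  add_mem' {B B'} h h' v := by
    change B v v + B' v v = 0
    rw [h v, h' v, add_zero]
  neg_mem' {B} h v := by
    change - B v v = 0
    rw [h v, neg_zero]

variable {R}

/-- The derivation `X + ξ^i ∂_i` of the product algebra. -/
def act (v : ProdVec R) : ProdAlg R lam →ₗ[ℝ] ProdAlg R lam :=
  LinearMap.rTensor (FuzzySphere lam) (v.1 : R →ₗ[ℝ] R)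
    + ∑ i, v.2 i • LinearMap.lTensor R (FuzzySphere.del lam i)

theorem act_tmul (v : ProdVec R) (r : R) (c : FuzzySphere lam) :
    act lam v (r ⊗ₜ[ℝ] c)
      = (v.1 r) ⊗ₜ[ℝ] c + ∑ i, (v.2 i * r) ⊗ₜ[ℝ] FuzzySphere.del lam i c := by
  simp [act, TensorProduct.smul_tmul']

theorem act_add (v w : ProdVec R) (a : ProdAlg R lam) :
    act lam (v + w) a = act lam v a + act lam w a := by
  induction a using TensorProduct.induction_on with
  | zero => simp
  | tmul r c =>
    simp only [act_tmul, Prod.fst_add, Prod.snd_add, Derivation.coe_add, Pi.add_apply, add_mul,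
      TensorProduct.add_tmul, Finset.sum_add_distrib]
    abel
  | add x y hx hy =>
    simp only [map_add, hx, hy]
    abel

theorem act_smul (r : R) (v : ProdVec R) (a : ProdAlg R lam) :
    act lam (r • v) a = r • act lam v a := by
  induction a using TensorProduct.induction_on with
  | zero => simp
  | tmul s c =>
    simp only [act_tmul, Prod.smul_fst, Prod.smul_snd, Derivation.coe_smul, Pi.smul_apply,
      smul_eq_mul, smul_add, Finset.smul_sum, TensorProduct.smul_tmul', mul_assoc]
  | add x y hx hy => simp only [map_add, hx, hy, smul_add]

theorem act_smul_right (v : ProdVec R) (r : R) (a : ProdAlg R lam) :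
    act lam v (r • a) = v.1 r • a + r • act lam v a := by
  induction a using TensorProduct.induction_on with
  | zero => simp
  | tmul s c =>
    simp only [act_tmul, smul_eq_mul, smul_add, Finset.smul_sum, TensorProduct.smul_tmul',
      Derivation.leibniz, TensorProduct.add_tmul]
    have : ∀ i, v.2 i * (r * s) = r * (v.2 i * s) := fun i => by ring
    simp only [this, mul_comm s (v.1 r)]
    abel
  | add x y hx hy =>
    simp only [smul_add, map_add, hx, hy]
    abel

/-- The bracket of `X + ξ^i ∂_i` and `Y + η^i ∂_i`, where `[∂_j, ∂_k] = ε_{jki} ∂_i`. -/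
def bracket (v w : ProdVec R) : ProdVec R :=
  (⁅v.1, w.1⁆, fun i => v.1 (w.2 i) - w.1 (v.2 i) + ∑ j, ∑ k, (eps j k i : R) * (v.2 j * w.2 k))

theorem bracket_self (v : ProdVec R) : bracket v v = 0 := by
  have hε : ∀ i j k, eps j k i = - eps k j i := by decide
  refine Prod.ext (lie_self _) (funext fun i => ?_)
  have h0 : ∀ j, eps j j i = 0 := by revert i; decide
  simp only [bracket, sub_self, zero_add, Prod.snd_zero, Pi.zero_apply, Fin.sum_univ_three, h0]
  rw [hε i 1 0, hε i 2 0, hε i 2 1]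
  push_cast
  ring

theorem bracket_add_left (u v w : ProdVec R) :
    bracket (u + v) w = bracket u w + bracket v w := by
  refine Prod.ext (add_lie _ _ _) (funext fun i => ?_)
  simp only [bracket, Prod.fst_add, Prod.snd_add, Derivation.coe_add, Pi.add_apply, map_add,
    add_mul, mul_add, Finset.sum_add_distrib]
  ring

theorem bracket_add_right (u v w : ProdVec R) :
    bracket u (v + w) = bracket u v + bracket u w := by
  refine Prod.ext (lie_add _ _ _) (funext fun i => ?_)
  simp only [bracket, Prod.fst_add, Prod.snd_add, Derivation.coe_add, Pi.add_apply, map_add,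
    mul_add, Finset.sum_add_distrib]
  ring

theorem bracket_smul_right (r : R) (v w : ProdVec R) :
    bracket v (r • w) = r • bracket v w + v.1 r • w := by
  refine Prod.ext ?_ (funext fun i => ?_)
  · ext f
    simp only [bracket, Derivation.commutator_apply, Prod.smul_fst, Prod.fst_add,
      Derivation.coe_add, Derivation.coe_smul, Pi.add_apply, Pi.smul_apply, smul_eq_mul,
      Derivation.leibniz]
    ring
  · simp only [bracket, Prod.smul_fst, Prod.smul_snd, Prod.snd_add, Pi.add_apply, Pi.smul_apply,
      Derivation.coe_smul, smul_eq_mul, Derivation.leibniz, mul_add, Finset.mul_sum]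
    have : ∀ j k, (eps j k i : R) * (v.2 j * (r * w.2 k))
        = r * ((eps j k i : R) * (v.2 j * w.2 k)) := fun j k => by ring
    simp only [this]
    ring

theorem bracket_smul_left (r : R) (v w : ProdVec R) :
    bracket (r • v) w = r • bracket v w - w.1 r • v := by
  have hsk : ∀ a b : ProdVec R, bracket a b = - bracket b a := fun a b => by
    have h := bracket_self (a + b)
    rw [bracket_add_left, bracket_add_right, bracket_add_right, bracket_self, bracket_self,
      zero_add, add_zero] at h
    exact eq_neg_of_add_eq_zero_left h
  rw [hsk (r • v) w, bracket_smul_right, hsk v w, smul_neg]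
  abel

variable (R)

/-- The exterior derivative on the product algebra, `da (v) = v(a)`. -/
def prodD : ProdAlg R lam →+ ProdForm R lam :=
  AddMonoidHom.mk' (fun a =>
    { toFun := fun v => act lam v a
      map_add' := fun v w => act_add lam v w a
      map_smul' := fun r v => act_smul lam r v a })
    (fun a b => by
      ext v <;> exact map_add (act lam _) a b)

/-- The exterior product of 1-forms, `(ω ∧ η)(v, w) = ω(v) η(w) - ω(w) η(v)`. -/
def prodWedge : BTensor (ProdAlg R lam) (ProdForm R lam) (ProdForm R lam) →+ prodForm2 R lam :=
  BTensor.lift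
    (AddMonoidHom.mk' (fun ω => AddMonoidHom.mk' (fun η =>
      (⟨LinearMap.mk₂ R (fun v w => ω v * η w - ω w * η v)
          (fun v v' w => by simp only [map_add, add_mul, mul_add]; abel)
          (fun r v w => by
            simp only [map_smul, smul_mul_assoc, mul_smul_comm, smul_sub])
          (fun v w w' => by simp only [map_add, add_mul, mul_add]; abel)
          (fun r v w => by
            simp only [map_smul, smul_mul_assoc, mul_smul_comm, smul_sub]),
        fun v => sub_self _⟩ : prodForm2 R lam))
      (fun η η' => by
        refine Subtype.ext (LinearMap.ext₂ fun v w => ?_)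
        change ω v * (η w + η' w) - ω w * (η v + η' v)
          = (ω v * η w - ω w * η v) + (ω v * η' w - ω w * η' v)
        simp only [mul_add]
        abel))
      (fun ω ω' => by
        refine AddMonoidHom.ext fun η => Subtype.ext (LinearMap.ext₂ fun v w => ?_)
        change (ω v + ω' v) * η w - (ω w + ω' w) * η v
          = (ω v * η w - ω w * η v) + (ω' v * η w - ω' w * η v)
        simp only [add_mul]
        abel))
    (fun ω a η => by
      refine Subtype.ext (LinearMap.ext₂ fun v w => ?_)
      change (ω v * a) * η w - (ω w * a) * η v = ω v * (a * η w) - ω w * (a * η v)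
      simp only [mul_assoc])

/-- The exterior derivative on 1-forms, `dω(v, w) = v(ω(w)) - w(ω(v)) - ω([v, w])`. -/
def prodD₁ : ProdForm R lam →+ prodForm2 R lam :=
  AddMonoidHom.mk' (fun ω =>
    (⟨LinearMap.mk₂ R (fun v w => act lam v (ω w) - act lam w (ω v) - ω (bracket v w))
        (fun v v' w => by
          simp only [map_add, act_add, bracket_add_left]
          abel)
        (fun r v w => by
          simp only [map_smul, act_smul, act_smul_right, bracket_smul_left, map_sub, smul_sub]
          abel)
        (fun v w w' => by
          simp only [map_add, act_add, bracket_add_right]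
          abel)
        (fun r v w => by
          simp only [map_smul, act_smul, act_smul_right, bracket_smul_right, map_add, smul_sub]
          abel),
      fun v => by simp [LinearMap.mk₂_apply, bracket_self]⟩ : prodForm2 R lam))
    (fun ω ω' => by
      refine Subtype.ext (LinearMap.ext₂ fun v w => ?_)
      change act lam v (ω w + ω' w) - act lam w (ω v + ω' v)
          - (ω (bracket v w) + ω' (bracket v w))
        = (act lam v (ω w) - act lam w (ω v) - ω (bracket v w))
          + (act lam v (ω' w) - act lam w (ω' v) - ω' (bracket v w))
      simp only [map_add]
      abel)

variable {R}

/-- A real 1-form on `M` as a 1-form on the product. -/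
def baseForm (ω : OneForm R) : ProdForm R lam :=
  Algebra.linearMap R (ProdAlg R lam) ∘ₗ ω ∘ₗ LinearMap.fst R (VecField R) (Fin 3 → R)

variable (R) in
/-- The central basis 1-forms `s^i` of the fuzzy sphere, as 1-forms on the product. -/
def fiberForm (i : Fin 3) : ProdForm R lam :=
  Algebra.linearMap R (ProdAlg R lam) ∘ₗ LinearMap.proj i ∘ₗ
    LinearMap.snd R (VecField R) (Fin 3 → R)

/-- The `*`-operation of the product algebra; real functions on `M` are self-adjoint. -/
def prodStar : ProdAlg R lam →+ ProdAlg R lam :=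
  (LinearMap.lTensor R (FuzzySphere.star lam)).toAddMonoidHom

theorem prodStar_tmul (r : R) (c : FuzzySphere lam) :
    prodStar lam (r ⊗ₜ[ℝ] c) = r ⊗ₜ[ℝ] FuzzySphere.star lam c := rfl

theorem prodStar_smul (r : R) (a : ProdAlg R lam) :
    prodStar lam (r • a) = r • prodStar lam a := by
  induction a using TensorProduct.induction_on with
  | zero => simp
  | tmul s c => simp only [TensorProduct.smul_tmul', prodStar_tmul]
  | add x y hx hy => simp only [smul_add, map_add, hx, hy]

theorem prodStar_mul (a b : ProdAlg R lam) :
    prodStar lam (a * b) = prodStar lam b * prodStar lam a := by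
  induction a using TensorProduct.induction_on with
  | zero => simp
  | add x y hx hy => simp only [add_mul, mul_add, map_add, hx, hy]
  | tmul r c =>
    induction b using TensorProduct.induction_on with
    | zero => simp
    | add x y hx hy => simp only [add_mul, mul_add, map_add, hx, hy]
    | tmul s e =>
      simp only [Algebra.TensorProduct.tmul_mul_tmul, prodStar_tmul, FuzzySphere.star_mul,
        mul_comm r s]

/-- The `*`-operation on 1-forms, for which real 1-forms on `M` and the `s^i` are self-adjoint. -/
def formStar : ProdForm R lam →+ ProdForm R lam :=
  AddMonoidHom.mk' (fun ω =>
    { toFun := fun v => prodStar lam (ω v)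
      map_add' := fun v w => by rw [map_add, map_add]
      map_smul' := fun r v => by rw [map_smul, prodStar_smul, RingHom.id_apply] })
    (fun ω ω' => LinearMap.ext fun v => map_add (prodStar lam) (ω v) (ω' v))

variable (R) in
/-- The operation `†` on 2-tensors of the product calculus. -/
def prodDagger : BTensor (ProdAlg R lam) (ProdForm R lam) (ProdForm R lam) →+
    BTensor (ProdAlg R lam) (ProdForm R lam) (ProdForm R lam) :=
  dagger (prodStar lam) (formStar lam)
    (fun a ω => LinearMap.ext fun v => prodStar_mul lam a (ω v))
    (fun a ω => LinearMap.ext fun v => prodStar_mul lam (ω v) a)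

/-- The bimodule connections on the product calculus. -/
abbrev ProdConnection (R : Type*) [CommRing R] [Algebra ℝ R] (lam : ℝ) : Type _ :=
  BimoduleConnection (prodD R lam)

/-- A connection is `*`-preserving if `∇ ∘ * = σ ∘ † ∘ ∇`. -/
def IsStarPreserving (D : ProdConnection R lam) : Prop :=
  ∀ ω, D.nabla (formStar lam ω) = D.sigma (prodDagger R lam (D.nabla ω))

/-- The generalised braiding is the flip on the real 1-forms on `M` and the `s^i`. As `σ` is a
bimodule map, over a coordinate patch this says that `σ` is the flip on the basis
`{dx^μ, s^i}`. -/
def IsFlipOnBasis (D : ProdConnection R lam) : Prop :=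
  ∀ α β : ProdForm R lam,
    ((∃ ω, α = baseForm lam ω) ∨ ∃ i, α = fiberForm R lam i) →
    ((∃ ω, β = baseForm lam ω) ∨ ∃ i, β = fiberForm R lam i) →
    D.sigma (tmul (ProdAlg R lam) α β) = tmul (ProdAlg R lam) β α

/-- A covariant 2-tensor on `M` as a 2-tensor of the product calculus. -/
def baseTensor : OneForm R ⊗[R] OneForm R →+
    BTensor (ProdAlg R lam) (ProdForm R lam) (ProdForm R lam) :=
  TensorProduct.liftAddHom
    (AddMonoidHom.mk' (fun ω => AddMonoidHom.mk'
        (fun η => tmul (ProdAlg R lam) (baseForm lam ω) (baseForm lam η))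
        (fun η η' => by
          rw [← tmul_add]
          refine congrArg _ (LinearMap.ext fun v => ?_)
          exact map_add (algebraMap R (ProdAlg R lam)) (η v.1) (η' v.1)))
      (fun ω ω' => AddMonoidHom.ext fun η => by
        change tmul _ (baseForm lam (ω + ω')) _ = tmul _ _ _ + tmul _ _ _
        rw [← add_tmul]
        refine congrArg (fun α => tmul _ α _) (LinearMap.ext fun v => ?_)
        exact map_add (algebraMap R (ProdAlg R lam)) (ω v.1) (ω' v.1)))
    (fun r ω η => by
      change tmul (ProdAlg R lam) (baseForm lam (r • ω)) (baseForm lam η)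
        = tmul (ProdAlg R lam) (baseForm lam ω) (baseForm lam (r • η))
      have h₁ : baseForm lam (r • ω)
          = op (algebraMap R (ProdAlg R lam) r) • baseForm lam ω :=
        LinearMap.ext fun v => by
          change algebraMap R (ProdAlg R lam) (r * ω v.1)
            = algebraMap R (ProdAlg R lam) (ω v.1) * algebraMap R (ProdAlg R lam) r
          rw [mul_comm, map_mul]
      have h₂ : baseForm lam (r • η) = algebraMap R (ProdAlg R lam) r • baseForm lam η :=
        LinearMap.ext fun v => by
          change algebraMap R (ProdAlg R lam) (r * η v.1)
            = algebraMap R (ProdAlg R lam) r * algebraMap R (ProdAlg R lam) (η v.1)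
          rw [map_mul]
      rw [h₁, h₂, tmul_balanced])

/-- The metric
`g_{μν} dx^μ ⊗ dx^ν + A_{μi} (dx^μ ⊗ s^i + s^i ⊗ dx^μ) + h_{ij} s^i ⊗ s^j`,
given by a 2-tensor `g` on `M`, the 1-forms `A_i = A_{μi} dx^μ` and the functions `h_{ij}`. -/
def prodMetric (g : OneForm R ⊗[R] OneForm R) (A : Fin 3 → OneForm R)
    (h : Matrix (Fin 3) (Fin 3) R) :
    BTensor (ProdAlg R lam) (ProdForm R lam) (ProdForm R lam) :=
  baseTensor lam g
    + ∑ i, (tmul (ProdAlg R lam) (baseForm lam (A i)) (fiberForm R lam i)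
        + tmul (ProdAlg R lam) (fiberForm R lam i) (baseForm lam (A i)))
    + ∑ i, ∑ j, algebraMap R (ProdAlg R lam) (h i j) •
        tmul (ProdAlg R lam) (fiberForm R lam i) (fiberForm R lam j)

/-- The coefficient of a 2-tensor on a pair of derivations, `(ω ⊗ η)(v, w) = ω(v) η(w)`. -/
def evalTensor (v w : ProdVec R) :
    BTensor (ProdAlg R lam) (ProdForm R lam) (ProdForm R lam) →+ ProdAlg R lam :=
  BTensor.lift
    (AddMonoidHom.mk' (fun ω => AddMonoidHom.mk' (fun η => ω v * η w)
        (fun η η' => mul_add (ω v) (η w) (η' w)))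
      (fun ω ω' => AddMonoidHom.ext fun η => add_mul (ω v) (ω' v) (η w)))
    (fun ω a η => mul_assoc (ω v) a (η w))

/-- The exact 1-form `df` on `M`. -/
def dBase (f : R) : OneForm R where
  toFun X := X f
  map_add' _ _ := rfl
  map_smul' _ _ := rfl

end Product

/-! ## Local coordinates and the coefficients of the connection -/

section Coordinates

open scoped Manifold ContDiff

variable {n : ℕ} {M : Type*} [TopologicalSpace M] [ChartedSpace (EuclideanSpace ℝ (Fin n)) M]

variable (n M) in
/-- The algebra of real smooth functions on `M`. -/
abbrev Smooth : Type _ := C^∞⟮𝓡 n, M; ℝ⟯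

/-- Evaluation at a point of `M`, `C^∞(M) ⊗ ℂ_λ[S²] → ℂ_λ[S²]`. -/
def evalAt (lam : ℝ) (p : M) : ProdAlg (Smooth n M) lam →ₗ[ℝ] FuzzySphere lam :=
  TensorProduct.lift
    { toFun := fun f => (f p) • LinearMap.id
      map_add' := fun f f' => by
        rw [← add_smul]
        rfl
      map_smul' := fun r f => by
        rw [RingHom.id_apply, smul_smul]
        rfl }

variable (n M) in
/-- Local coordinates `x^μ` on an open subset of `M`, cut off to smooth functions on `M`, with
coordinate vector fields `∂_μ`: over the domain, `∂_μ x^ν = δ_μ^ν` and `X = X(x^μ) ∂_μ` for all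
vector fields `X`. -/
structure LocalCoordinates where
  /-- The coordinate patch. -/
  domain : TopologicalSpace.Opens M
  /-- The coordinates `x^μ`. -/
  x : Fin n → Smooth n M
  /-- The coordinate vector fields `∂_μ`. -/
  del : Fin n → VecField (Smooth n M)
  del_x : ∀ μ ν, ∀ p ∈ domain, del μ (x ν) p = if μ = ν then 1 else 0
  expand : ∀ (X : VecField (Smooth n M)) (f : Smooth n M), ∀ p ∈ domain,
    X f p = ∑ μ, X (x μ) p * del μ f p

namespace LocalCoordinates

variable (c : LocalCoordinates n M)
variable (g : OneForm (Smooth n M) ⊗[Smooth n M] OneForm (Smooth n M))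
variable (A : Fin 3 → OneForm (Smooth n M))
variable (h : Matrix (Fin 3) (Fin 3) (Smooth n M))

/-- The components `g_{μν}`. -/
def gLo (μ ν : Fin n) : Smooth n M :=
  TensorProduct.dualDistrib (Smooth n M) (VecField (Smooth n M)) (VecField (Smooth n M)) g
    (c.del μ ⊗ₜ[Smooth n M] c.del ν)

/-- The components `A_{μi}`. -/
def ALo (μ : Fin n) (i : Fin 3) : Smooth n M := A i (c.del μ)

/-- The functions `A_{μj} h^{ij}`, where `h^{ij}` is the inverse matrix of `h_{ij}`. -/
def AUp (μ : Fin n) (i : Fin 3) : Smooth n M := ∑ j, c.ALo A μ j * h⁻¹ i j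

/-- The effective metric `g̃_{μν} = g_{μν} - h^{ij} A_{iμ} A_{jν}`. -/
def gtLo (μ ν : Fin n) : Smooth n M :=
  c.gLo g μ ν - ∑ i, ∑ j, h⁻¹ i j * c.ALo A μ i * c.ALo A ν j

variable (p : M)

/-- The inverse matrix `g^{μν}` at `p`. -/
def gUp : Matrix (Fin n) (Fin n) ℝ := (Matrix.of fun μ ν => c.gLo g μ ν p)⁻¹

/-- The inverse matrix `g̃^{μν}` of the effective metric at `p`. -/
def gtUp : Matrix (Fin n) (Fin n) ℝ := (Matrix.of fun μ ν => c.gtLo g A h μ ν p)⁻¹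

/-- The matrix `h̃_{ij} = h_{ij} - g^{μν} A_{iμ} A_{jν}` at `p`. -/
def htLo : Matrix (Fin 3) (Fin 3) ℝ :=
  Matrix.of fun i j => h i j p
    - ∑ μ, ∑ ν, c.gUp g p μ ν * c.ALo A μ i p * c.ALo A ν j p

/-- The inverse matrix `h̃^{ij}` at `p`. -/
def htUp : Matrix (Fin 3) (Fin 3) ℝ := (c.htLo g A h p)⁻¹

/-- `∂_α A_{βi} - ∂_β A_{αi}` at `p`. -/
def curlA (α β : Fin n) (i : Fin 3) : ℝ :=
  c.del α (c.ALo A β i) p - c.del β (c.ALo A α i) p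

/-- `∂_α (A_{βj} h^{ij}) - ∂_β (A_{αj} h^{ij})` at `p`. -/
def curlAUp (α β : Fin n) (i : Fin 3) : ℝ :=
  c.del α (c.AUp A h β i) p - c.del β (c.AUp A h α i) p

/-- The Christoffel symbols `Γ̃^σ_{μν}` of the effective metric at `p`. -/
def christoffel (σ μ ν : Fin n) : ℝ :=
  1 / 2 * ∑ ρ, c.gtUp g A h p σ ρ * (c.del μ (c.gtLo g A h ν ρ) p + c.del ν (c.gtLo g A h μ ρ) p
    - c.del ρ (c.gtLo g A h μ ν) p)

/-- `Γ^σ_{μν} = Γ̃^σ_{μν} + ½ g̃^{σρ} (A_{μi} ∂_{[ν} (A_{ρ]j} h^{ij}) + A_{νi} ∂_{[μ} (A_{ρ]j} h^{ij})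
+ A_{iμ} A_{jν} ∂_ρ h^{ij})`; here and below brackets denote antisymmetrisation without a factor. -/
def coefΓ (σ μ ν : Fin n) : ℝ :=
  c.christoffel g A h p σ μ ν + 1 / 2 * ∑ ρ, c.gtUp g A h p σ ρ *
    (∑ i, c.ALo A μ i p * c.curlAUp A h p ν ρ i + ∑ i, c.ALo A ν i p * c.curlAUp A h p μ ρ i
      + ∑ i, ∑ j, c.ALo A μ i p * c.ALo A ν j p * c.del ρ (h⁻¹ i j) p)

/-- `∇_α A_{βi} = ∂_α A_{βi} - Γ^μ_{αβ} A_{μi}` at `p`. -/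
def covA (α β : Fin n) (i : Fin 3) : ℝ :=
  c.del α (c.ALo A β i) p - ∑ μ, c.coefΓ g A h p μ α β * c.ALo A μ i p

/-- `E^k_{αβ} = -½ h^{ki} (∇_α A_{βi} + ∇_β A_{αi})`. -/
def coefE (k : Fin 3) (α β : Fin n) : ℝ :=
  -(1 / 2) * ∑ i, h⁻¹ k i p * (c.covA g A h p α β i + c.covA g A h p β α i)

/-- `F^μ_{αi} = ½ g̃^{βμ} (-∂_{[α} A_{β]i} + h^{jk} A_{kβ} (∂_α h_{ij} - A_{αl} ε_{ijl}))`. -/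
def coefF (μ α : Fin n) (i : Fin 3) : ℝ :=
  1 / 2 * ∑ β, c.gtUp g A h p β μ * (-c.curlA A p α β i
    + ∑ j, ∑ k, h⁻¹ j k p * c.ALo A β k p *
      (c.del α (h i j) p - ∑ l, c.ALo A α l p * (eps i j l : ℝ)))

/-- `B^k_{αi} = ½ h̃^{jk} (g^{μβ} A_{jμ} ∂_{[α} A_{β]i} + A_{lα} ε_{ijl} - ∂_α h_{ij})`. -/
def coefB (k : Fin 3) (α : Fin n) (i : Fin 3) : ℝ :=
  1 / 2 * ∑ j, c.htUp g A h p j k *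
    (∑ μ, ∑ β, c.gUp g p μ β * c.ALo A μ j p * c.curlA A p α β i
      + ∑ l, c.ALo A α l p * (eps i j l : ℝ) - c.del α (h i j) p)

/-- `h_{n(i} ε_{j)mn} = h_{ni} ε_{jmn} + h_{nj} ε_{imn}` at `p`. -/
def hEps (h : Matrix (Fin 3) (Fin 3) (Smooth n M)) (p : M) (i j m : Fin 3) : ℝ :=
  ∑ q, (h q i p * (eps j m q : ℝ) + h q j p * (eps i m q : ℝ))

/-- `D^μ_{ij} = ½ g̃^{μα} (∂_α h_{ij} - A_{kα} h^{mk} h_{n(i} ε_{j)mn})`. -/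
def coefD (μ : Fin n) (i j : Fin 3) : ℝ :=
  1 / 2 * ∑ α, c.gtUp g A h p μ α *
    (c.del α (h i j) p - ∑ k, ∑ m, c.ALo A α k p * h⁻¹ m k p * hEps h p i j m)

/-- `H^l_{ik} = ½ h̃^{jl} (h_{n(i} ε_{k)jn} - A_{jμ} g^{μα} ∂_α h_{ik}) - ½ ε_{lik}`. -/
def coefH (l i k : Fin 3) : ℝ :=
  1 / 2 * ∑ j, c.htUp g A h p j l *
    (hEps h p i k j - ∑ μ, ∑ α, c.ALo A μ j p * c.gUp g p μ α * c.del α (h i k) p)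
    - 1 / 2 * (eps l i k : ℝ)

/-- The vector field `∂_μ` as a derivation along the product. -/
def e (μ : Fin n) : ProdVec (Smooth n M) := (c.del μ, 0)

variable (n M) in
/-- The derivation `∂_i` of the fuzzy sphere as a derivation along the product. -/
def f (i : Fin 3) : ProdVec (Smooth n M) := (0, Pi.single i 1)

/-- The coefficient at `p` of `∇α` along `v ⊗ w` is the real number `r`. For `v` and `w` among the
`∂_μ` and `∂_i`, which are dual to `dx^μ` and `s^i`, these are the coefficients of `∇α` in the basis
of products of the `dx^μ` and `s^i`. -/
def HasCoef {lam : ℝ} (D : ProdConnection (Smooth n M) lam) (α : ProdForm (Smooth n M) lam)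
    (p : M) (v w : ProdVec (Smooth n M)) (r : ℝ) : Prop :=
  evalAt lam p (evalTensor lam v w (D.nabla α)) = algebraMap ℝ (FuzzySphere lam) r

variable {lam : ℝ} (D : ProdConnection (Smooth n M) lam)

/-- The 1-form `dx^μ` on the product. -/
def dx (lam : ℝ) (μ : Fin n) : ProdForm (Smooth n M) lam := baseForm lam (dBase (c.x μ))

/-- The 1-form `s^i` on the product. -/
def s (n : ℕ) (M : Type*) [TopologicalSpace M] [ChartedSpace (EuclideanSpace ℝ (Fin n)) M]
    (lam : ℝ) (i : Fin 3) : ProdForm (Smooth n M) lam := fiberForm (Smooth n M) lam i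

/-- The coefficients `Γ`, `F`, `D`, `E` in
`∇dx^μ = -Γ^μ_{αβ} dx^α ⊗ dx^β + F^μ_{αi} (dx^α ⊗ s^i + s^i ⊗ dx^α) + D^μ_{ij} s^i ⊗ s^j` and
`∇s^k = E^k_{αβ} dx^α ⊗ dx^β + ⋯` at `p`. -/
def HasCoefΓFDE : Prop :=
  (∀ μ α β, HasCoef D (c.dx lam μ) p (c.e α) (c.e β) (-c.coefΓ g A h p μ α β)) ∧
  (∀ μ α i, HasCoef D (c.dx lam μ) p (c.e α) (f n M i) (c.coefF g A h p μ α i)) ∧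
  (∀ μ α i, HasCoef D (c.dx lam μ) p (f n M i) (c.e α) (c.coefF g A h p μ α i)) ∧
  (∀ μ i j, HasCoef D (c.dx lam μ) p (f n M i) (f n M j) (c.coefD g A h p μ i j)) ∧
  (∀ k α β, HasCoef D (s n M lam k) p (c.e α) (c.e β) (c.coefE g A h p k α β))

/-- The coefficients `B`, `H` in
`∇s^k = ⋯ + B^k_{αi} (dx^α ⊗ s^i + s^i ⊗ dx^α) + H^k_{ij} s^i ⊗ s^j` at `p`. -/
def HasCoefBH : Prop :=
  (∀ k α i, HasCoef D (s n M lam k) p (c.e α) (f n M i) (c.coefB g A h p k α i)) ∧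
  (∀ k α i, HasCoef D (s n M lam k) p (f n M i) (c.e α) (c.coefB g A h p k α i)) ∧
  (∀ k i j, HasCoef D (s n M lam k) p (f n M i) (f n M j) (c.coefH g A h p k i j))

end LocalCoordinates

end Coordinates

end QRG

end

open scoped Manifold ContDiff

noncomputable section

namespace QRG

/-! ### Tensor products over a noncommutative ring, and the derivations and `*` of the product
algebra -/

section

/-! The derivations along `M` and the `∂_i` of the fuzzy sphere span an `R`-module `ProdVec R` with
a bracket, and the calculus is built from it by the classical formulas for forms and their exterior
derivative. The coefficients of the metric lie in the central subalgebra `R`, so `𝔤` amounts to an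
ordinary symmetric bilinear form on `ProdVec R`, and the classical Levi-Civita argument can be run.
A braiding that is the flip on the central forms `dx^μ`, `s^i` is the transposition of the
coefficients `t(u, v)` of a 2-tensor. Torsion freeness and metric compatibility then read as in
Riemannian geometry.

Neither a global basis of 1-forms nor the isomorphism of vectors with 1-forms is given; the pairing
`( , )` stands in for both. If `𝔤 = ∑ α_k ⊗ β_k` with real `α_k, β_k`, the inverse property `θ = ∑
(θ, α_k) β_k` is a dual basis property. Hence 2- and 3-tensors are determined by their coefficients
(`tensor_ext`, `tensor₃_eq_zero`), and every `R`-bilinear map is the coefficient map of a 2-tensor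
(`tensorOf`).

Existence: let `C(u, v)` be the real form given by the Koszul expression, classically `2𝔤(∇_u v,
·)`. The formula `(∇θ)(u, v) = u(θ(v)) - ½ (C(u, v), θ)` defines the connection without mentioning a
vector `∇_u v`. Its properties are formal consequences of the identities for `C` and of `(𝔤(v, ·),
θ) = θ(v)`; it preserves `*` because `C` is real. Uniqueness: the difference of two such connections
is left linear, and on `𝔤(w, ·)` it gives a function of `u, v, w` symmetric in the first two
arguments and antisymmetric in the last two, hence zero; left linear maps are determined on the
forms `𝔤(w, ·)` (`eq_zero_of_frameForm`).

Coefficients: bump functions localise everything to a patch. At a point of it the pairings of `C(u,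
v)` with the `dx^μ` and `s^i` solve a linear system whose matrix is that of `𝔤`. As the fuzzy sphere
is nonzero (it acts on a completed Verma module), this matrix is invertible over `ℝ` and the
solution is real. Eliminating the `s` block yields the Schur complement `g̃` and the formulas for
`Γ, F, D, E`; eliminating the `dx` block yields `h̃` and the formulas for `B, H`. What remains are
algebraic identities. -/

theorem BTensor.induction_on {A : Type*} [Ring A] {M : Type*} [AddCommGroup M] [Module Aᵐᵒᵖ M]
    {N : Type*} [AddCommGroup N] [Module A N] {motive : BTensor A M N → Prop}
    (t : BTensor A M N) (zero : motive 0) (tmul : ∀ m n, motive (tmul A m n))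
    (add : ∀ x y, motive x → motive y → motive (x + y)) : motive t := by
  obtain ⟨t, rfl⟩ : ∃ t', BTensor.mk A M N t' = t :=
    QuotientAddGroup.mk'_surjective (balancedRel A M N) t
  induction t using TensorProduct.induction_on with
  | zero => simpa using zero
  | tmul m n => exact tmul m n
  | add x y hx hy => simpa only [map_add] using add _ _ hx hy

theorem BTensor.exists_sum {A : Type*} [Ring A] {M : Type*} [AddCommGroup M] [Module Aᵐᵒᵖ M]
    {N : Type*} [AddCommGroup N] [Module A N] (t : BTensor A M N) :
    ∃ (k : ℕ) (m : Fin k → M) (n : Fin k → N), t = ∑ i, tmul A (m i) (n i) := by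
  induction t using BTensor.induction_on with
  | zero => exact ⟨0, 0, 0, by simp⟩
  | tmul m n => exact ⟨1, fun _ => m, fun _ => n, by simp⟩
  | add x y hx hy =>
    obtain ⟨k, m, n, rfl⟩ := hx
    obtain ⟨l, m', n', rfl⟩ := hy
    exact ⟨k + l, Fin.append m m', Fin.append n n', by simp [Fin.sum_univ_add]⟩

section

variable {A : Type*} [Ring A] {M : Type*} [AddCommGroup M] [Module Aᵐᵒᵖ M]
    {N : Type*} [AddCommGroup N] [Module A N] {ι : Type*}

theorem tmul_sum (s : Finset ι) (m : M) (n : ι → N) :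
    tmul A m (∑ i ∈ s, n i) = ∑ i ∈ s, tmul A m (n i) :=
  map_sum (tmulHom (A := A) (N := N) m) n s

theorem sum_tmul (s : Finset ι) (m : ι → M) (n : N) :
    tmul A (∑ i ∈ s, m i) n = ∑ i ∈ s, tmul A (m i) n :=
  map_sum ((tmulHom (A := A) (M := M) (N := N)).flip n) m s

theorem tmul_zero (m : M) : tmul A m (0 : N) = 0 := map_zero (tmulHom (A := A) (N := N) m)

theorem zero_tmul (n : N) : tmul A (0 : M) n = 0 :=
  map_zero ((tmulHom (A := A) (M := M) (N := N)).flip n)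

theorem sub_tmul (m m' : M) (n : N) : tmul A (m - m') n = tmul A m n - tmul A m' n :=
  map_sub ((tmulHom (A := A) (M := M) (N := N)).flip n) m m'

end

variable {R : Type*} [CommRing R] [Algebra ℝ R] {lam : ℝ}

theorem FuzzySphere.del_mul (i : Fin 3) (a b : FuzzySphere lam) :
    FuzzySphere.del lam i (a * b)
      = FuzzySphere.del lam i a * b + a * FuzzySphere.del lam i b := by
  simp only [FuzzySphere.del, LinearMap.smul_apply, LinearMap.sub_apply,
    LinearMap.mulLeft_apply, LinearMap.mulRight_apply, smul_mul_assoc, mul_smul_comm, ← smul_add]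
  congr 1
  noncomm_ring

/-- Two signs cancel: `[y, a]^* = -[y, a^*]` for self-adjoint `y`, and `1 / (2iλ)` is purely
imaginary. -/
theorem FuzzySphere.del_star (i : Fin 3) (a : FuzzySphere lam) :
    FuzzySphere.del lam i (FuzzySphere.star lam a)
      = FuzzySphere.star lam (FuzzySphere.del lam i a) := by
  have h2 : starRingEnd ℂ 2 = 2 := map_ofNat _ 2
  simp only [FuzzySphere.del, LinearMap.smul_apply, LinearMap.sub_apply,
    LinearMap.mulLeft_apply, LinearMap.mulRight_apply, FuzzySphere.star_smul, map_sub,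
    FuzzySphere.star_mul, FuzzySphere.star_y, map_div₀, map_mul, map_one, h2, Complex.conj_I,
    Complex.conj_ofReal]
  rw [← neg_sub, smul_neg, ← neg_smul]
  congr 1
  simp [div_eq_mul_inv, mul_comm]

theorem act_mul (v : ProdVec R) (a b : ProdAlg R lam) :
    act lam v (a * b) = act lam v a * b + a * act lam v b := by
  induction a using TensorProduct.induction_on with
  | zero => simp
  | add x y hx hy => simp only [add_mul, map_add, hx, hy]; abel
  | tmul r c =>
    induction b using TensorProduct.induction_on with
    | zero => simp
    | add x y hx hy => simp only [mul_add, map_add, hx, hy]; abel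
    | tmul s e =>
      simp only [Algebra.TensorProduct.tmul_mul_tmul, act_tmul, FuzzySphere.del_mul,
        Derivation.leibniz, smul_eq_mul, TensorProduct.add_tmul, TensorProduct.tmul_add,
        add_mul, mul_add, Finset.sum_add_distrib, Finset.sum_mul, Finset.mul_sum]
      have h1 : ∀ i, v.2 i * r * s = v.2 i * (r * s) := fun i => mul_assoc _ _ _
      have h2 : ∀ i, r * (v.2 i * s) = v.2 i * (r * s) := fun i => by ring
      simp only [h1, h2, mul_comm s (v.1 r)]
      abel

/-- The fuzzy part of `v` is a combination of commutators, which vanish on the unit of the fuzzy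
sphere. -/
theorem act_algebraMap (v : ProdVec R) (r : R) :
    act lam v (algebraMap R (ProdAlg R lam) r) = algebraMap R (ProdAlg R lam) (v.1 r) := by
  have h : ∀ i, FuzzySphere.del lam i 1 = 0 := fun i => by simp [FuzzySphere.del]
  rw [Algebra.TensorProduct.algebraMap_apply, Algebra.TensorProduct.algebraMap_apply, act_tmul]
  simp [h]

theorem act_prodStar (v : ProdVec R) (a : ProdAlg R lam) :
    act lam v (prodStar lam a) = prodStar lam (act lam v a) := by
  induction a using TensorProduct.induction_on with
  | zero => simp
  | add x y hx hy => simp only [map_add, hx, hy]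
  | tmul r c =>
    simp only [prodStar_tmul, act_tmul, map_add, map_sum, FuzzySphere.del_star]

theorem prodStar_algebraMap (r : R) :
    prodStar lam (algebraMap R (ProdAlg R lam) r) = algebraMap R (ProdAlg R lam) r := by
  have h : FuzzySphere.star lam 1 = 1 := by
    change FuzzySphere.ofConjOp lam (FuzzySphere.starHom lam 1) = 1
    rw [map_one]; rfl
  rw [Algebra.TensorProduct.algebraMap_apply, prodStar_tmul]
  simp [h]

theorem FuzzySphere.star_algebraMap (c : ℂ) :
    FuzzySphere.star lam (algebraMap ℂ _ c) = algebraMap ℂ _ (starRingEnd ℂ c) := by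
  change FuzzySphere.ofConjOp lam (FuzzySphere.starHom lam (algebraMap ℂ _ c)) = _
  rw [AlgHom.commutes]
  rfl

theorem FuzzySphere.star_star (a : FuzzySphere lam) :
    FuzzySphere.star lam (FuzzySphere.star lam a) = a := by
  obtain ⟨a, rfl⟩ : ∃ b, FuzzySphere.mk lam b = a :=
    RingQuot.mkAlgHom_surjective ℂ (FuzzyRel lam) a
  induction a using FreeAlgebra.induction with
  | grade0 c => simp [AlgHom.commutes, FuzzySphere.star_algebraMap]
  | grade1 i =>
    change FuzzySphere.star lam (FuzzySphere.star lam (FuzzySphere.y lam i)) = _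
    rw [FuzzySphere.star_y, FuzzySphere.star_y]
    rfl
  | mul a b ha hb => rw [map_mul, FuzzySphere.star_mul, FuzzySphere.star_mul, ha, hb]
  | add a b ha hb => simp only [map_add, ha, hb]

theorem prodStar_prodStar (a : ProdAlg R lam) : prodStar lam (prodStar lam a) = a := by
  induction a using TensorProduct.induction_on with
  | zero => simp
  | add x y hx hy => simp only [map_add, hx, hy]
  | tmul r c => simp only [prodStar_tmul, FuzzySphere.star_star]

/-! ### Real forms -/

variable (lam) in
/-- A real-valued `R`-linear form on `ProdVec R` as a central 1-form of the product calculus. -/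
def realForm : Module.Dual R (ProdVec R) →ₗ[R] ProdForm R lam :=
  LinearMap.compRight R (Algebra.linearMap R (ProdAlg R lam))

@[simp] theorem realForm_apply (η : Module.Dual R (ProdVec R)) (v : ProdVec R) :
    realForm lam η v = algebraMap R (ProdAlg R lam) (η v) := rfl

@[simp] theorem form_smul_apply (a : ProdAlg R lam) (θ : ProdForm R lam) (v : ProdVec R) :
    (a • θ) v = a * θ v := rfl

@[simp] theorem form_op_smul_apply (a : ProdAlg R lam) (θ : ProdForm R lam) (v : ProdVec R) :
    (op a • θ) v = θ v * a := rfl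

/-- The values of a real form come from `R`, which is central. This is what lets scalars pass across
the metric below. -/
theorem op_smul_realForm (a : ProdAlg R lam) (η : Module.Dual R (ProdVec R)) :
    op a • realForm lam η = a • realForm lam η :=
  LinearMap.ext fun v => Algebra.commutes (η v) a

theorem algebraMap_smul_form (r : R) (θ : ProdForm R lam) :
    algebraMap R (ProdAlg R lam) r • θ = r • θ :=
  LinearMap.ext fun v => (Algebra.smul_def r (θ v)).symm

@[simp] theorem evalTensor_tmul (v w : ProdVec R) (θ η : ProdForm R lam) :
    evalTensor lam v w (tmul (ProdAlg R lam) θ η) = θ v * η w := rfl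

theorem evalTensor_smul (v w : ProdVec R) (a : ProdAlg R lam)
    (t : BTensor (ProdAlg R lam) (ProdForm R lam) (ProdForm R lam)) :
    evalTensor lam v w (a • t) = a * evalTensor lam v w t := by
  induction t using BTensor.induction_on with
  | zero => simp
  | tmul θ η => rw [BTensor.smul_tmul, evalTensor_tmul, evalTensor_tmul, form_smul_apply, mul_assoc]
  | add x y hx hy => rw [smul_add, map_add, map_add, hx, hy, mul_add]

theorem evalTensor_op_smul (v w : ProdVec R) (a : ProdAlg R lam)
    (t : BTensor (ProdAlg R lam) (ProdForm R lam) (ProdForm R lam)) :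
    evalTensor lam v w (op a • t) = evalTensor lam v w t * a := by
  induction t using BTensor.induction_on with
  | zero => simp
  | tmul θ η =>
    rw [BTensor.op_smul_tmul, evalTensor_tmul, evalTensor_tmul, form_op_smul_apply, mul_assoc]
  | add x y hx hy => rw [smul_add, map_add, map_add, hx, hy, add_mul]

/-- The bilinear map `(v, w) ↦ t(v, w)` of a 2-tensor `t`. -/
def evalBilin (t : BTensor (ProdAlg R lam) (ProdForm R lam) (ProdForm R lam)) :
    ProdVec R →ₗ[R] ProdVec R →ₗ[R] ProdAlg R lam :=
  LinearMap.mk₂ R (fun v w => evalTensor lam v w t)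
    (fun v v' w => by
      induction t using BTensor.induction_on with
      | zero => simp
      | tmul θ η => simp [add_mul]
      | add x y hx hy => simp only [map_add, hx, hy]; abel)
    (fun r v w => by
      induction t using BTensor.induction_on with
      | zero => simp
      | tmul θ η => simp
      | add x y hx hy => simp only [map_add, hx, hy, smul_add])
    (fun v w w' => by
      induction t using BTensor.induction_on with
      | zero => simp
      | tmul θ η => simp [mul_add]
      | add x y hx hy => simp only [map_add, hx, hy]; abel)
    (fun r v w => by
      induction t using BTensor.induction_on with
      | zero => simp
      | tmul θ η => simp
      | add x y hx hy => simp only [map_add, hx, hy, smul_add])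

@[simp] theorem evalBilin_apply (t : BTensor (ProdAlg R lam) (ProdForm R lam) (ProdForm R lam))
    (v w : ProdVec R) : evalBilin t v w = evalTensor lam v w t := rfl

variable (lam) in
/-- The coefficient of a 3-tensor on a triple of derivations. -/
def evalTensor₃ (u v w : ProdVec R) :
    BTensor (ProdAlg R lam) (BTensor (ProdAlg R lam) (ProdForm R lam) (ProdForm R lam))
      (ProdForm R lam) →+ ProdAlg R lam :=
  BTensor.lift
    (AddMonoidHom.mk' (fun t => AddMonoidHom.mk' (fun η => evalTensor lam u v t * η w)
        (fun η η' => mul_add _ (η w) (η' w)))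
      (fun t t' => AddMonoidHom.ext fun η => by
        change evalTensor lam u v (t + t') * η w = _ * _ + _ * _
        rw [map_add, add_mul]))
    (fun t a η => by
      change evalTensor lam u v (op a • t) * η w = evalTensor lam u v t * (a * η w)
      rw [evalTensor_op_smul, mul_assoc])

@[simp] theorem evalTensor₃_tmul (u v w : ProdVec R)
    (t : BTensor (ProdAlg R lam) (ProdForm R lam) (ProdForm R lam)) (η : ProdForm R lam) :
    evalTensor₃ lam u v w (tmul (ProdAlg R lam) t η) = evalTensor lam u v t * η w := rfl

/-! ### Frames adapted to a metric -/

variable {ι : Type*} [Fintype ι]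

/-- The real bilinear form `∑ α_k ⊗ β_k`. -/
def frameForm (α β : ι → Module.Dual R (ProdVec R)) : ProdVec R →ₗ[R] Module.Dual R (ProdVec R) :=
  ∑ k, (α k).smulRight (β k)

theorem frameForm_eq (α β : ι → Module.Dual R (ProdVec R)) (v : ProdVec R) :
    frameForm α β v = ∑ k, α k v • β k := by
  simp [frameForm, LinearMap.sum_apply]

theorem frameForm_apply (α β : ι → Module.Dual R (ProdVec R)) (v w : ProdVec R) :
    frameForm α β v w = ∑ k, α k v * β k w := by
  simp [frameForm_eq]

/-- The real forms `α_k`, `β_k` give a symmetric metric `∑ α_k ⊗ β_k` with inverse `p`. -/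
structure IsMetricFrame (lam : ℝ) (α β : ι → Module.Dual R (ProdVec R))
    (p : BTensor (ProdAlg R lam) (ProdForm R lam) (ProdForm R lam) →+ ProdAlg R lam) : Prop where
  symm : ∀ v w, frameForm α β v w = frameForm α β w v
  bimodule : IsBimoduleMap (ProdAlg R lam) p
  left : ∀ θ, ∑ k, p (tmul _ θ (realForm lam (α k))) • realForm lam (β k) = θ
  right : ∀ θ, ∑ k, op (p (tmul _ (realForm lam (β k)) θ)) • realForm lam (α k) = θ

namespace IsMetricFrame

variable {α β : ι → Module.Dual R (ProdVec R)}
  {p : BTensor (ProdAlg R lam) (ProdForm R lam) (ProdForm R lam) →+ ProdAlg R lam}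
  (H : IsMetricFrame lam α β p)

include H

theorem pair_smul_left (a : ProdAlg R lam) (θ η : ProdForm R lam) :
    p (tmul _ (a • θ) η) = a * p (tmul _ θ η) := by
  rw [← BTensor.smul_tmul, H.bimodule.1]; rfl

theorem pair_smul_right (a : ProdAlg R lam) (θ η : ProdForm R lam) :
    p (tmul _ θ (op a • η)) = p (tmul _ θ η) * a := by
  rw [← BTensor.op_smul_tmul, H.bimodule.2]; rfl

theorem pair_smul_realForm (a : ProdAlg R lam) (θ : ProdForm R lam)
    (η : Module.Dual R (ProdVec R)) :
    p (tmul _ θ (a • realForm lam η)) = p (tmul _ θ (realForm lam η)) * a := by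
  rw [← op_smul_realForm, H.pair_smul_right]

/-- The scalar crosses the tensor sign, then the central form, and leaves on the left. So pairing
with a real form on the left is a bimodule map in the other argument. -/
theorem pair_realForm_smul (a : ProdAlg R lam) (η : Module.Dual R (ProdVec R))
    (θ : ProdForm R lam) :
    p (tmul _ (realForm lam η) (a • θ)) = a * p (tmul _ (realForm lam η) θ) := by
  rw [← tmul_balanced, op_smul_realForm, H.pair_smul_left]

theorem apply_eq_left (θ : ProdForm R lam) (v : ProdVec R) :
    θ v = ∑ k, p (tmul _ θ (realForm lam (α k))) * algebraMap R _ (β k v) := by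
  conv_lhs => rw [← H.left θ]
  simp [LinearMap.sum_apply]

/-- Evaluate the expansion `θ = ∑ α_k (β_k, θ)` at `v`. It replaces the musical isomorphism: pairing
with `𝔤(v, ·)` is evaluation at `v`. -/
theorem pair_frameForm (θ : ProdForm R lam) (v : ProdVec R) :
    p (tmul _ (realForm lam (frameForm α β v)) θ) = θ v := by
  conv_rhs => rw [← H.right θ]
  simp only [frameForm_eq, map_sum, map_smul, sum_tmul, LinearMap.sum_apply, form_op_smul_apply,
    realForm_apply]
  refine Finset.sum_congr rfl fun k _ => ?_
  rw [← algebraMap_smul_form, H.pair_smul_left]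

theorem frameForm_eq' (v : ProdVec R) : frameForm α β v = ∑ k, β k v • α k := by
  refine LinearMap.ext fun w => ?_
  rw [H.symm, frameForm_apply]
  simp [mul_comm]

/-- A left-linear map vanishing on the forms `𝔤(v, ·)` vanishes. -/
theorem eq_zero_of_frameForm {d : ProdForm R lam →+ ProdAlg R lam}
    (hd : ∀ (a : ProdAlg R lam) θ, d (a • θ) = a * d θ)
    (h0 : ∀ v, d (realForm lam (frameForm α β v)) = 0) (θ : ProdForm R lam) : d θ = 0 := by
  -- The values `∑ α_k(v) d(β_k)` of this form are `d(𝔤(v, ·)) = 0`. Pairing it with `θ` from the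
  -- left gives `∑ (θ, α_k) d(β_k)`, which is `d θ`.
  have key : ∑ k, d (realForm lam (β k)) • realForm lam (α k) = 0 := by
    refine LinearMap.ext fun v => ?_
    rw [LinearMap.sum_apply, LinearMap.zero_apply, ← h0 v, frameForm_eq]
    simp only [map_sum, map_smul, form_smul_apply, realForm_apply]
    refine Finset.sum_congr rfl fun k _ => ?_
    rw [← algebraMap_smul_form, hd, Algebra.commutes]
  rw [← H.left θ, map_sum]
  have := congrArg (fun η => p (tmul _ θ η)) key
  simpa only [tmul_sum, map_sum, tmul_zero, map_zero, H.pair_smul_realForm, hd] using this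

/-- The dual basis argument, for a first factor `P` on which the right linear maps `e x` separate
points: used with `P = Ω` for 2-tensors and then with `P = Ω ⊗ Ω` for 3-tensors. For `t = ∑ m_i ⊗
η_i`, the hypothesis says `∑ e_x(m_i) η_i = 0`; pairing with `α_k` and separating points gives `∑
m_i (η_i, α_k) = 0`. Expanding each `η_i` in the `β_k` turns `t` into `∑_k (∑_i m_i (η_i, α_k)) ⊗
β_k`. -/
theorem tensor_eq_zero {P : Type*} [AddCommGroup P] [Module (ProdAlg R lam)ᵐᵒᵖ P]
    (t : BTensor (ProdAlg R lam) P (ProdForm R lam))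
    {E : Type*} (e : E → P →+ ProdAlg R lam) (he : ∀ x a m, e x (op a • m) = e x m * a)
    (hinj : ∀ m, (∀ x, e x m = 0) → m = 0)
    (f : E → ProdVec R → BTensor (ProdAlg R lam) P (ProdForm R lam) →+ ProdAlg R lam)
    (hf : ∀ x v m η, f x v (tmul _ m η) = e x m * η v)
    (h0 : ∀ x v, f x v t = 0) : t = 0 := by
  obtain ⟨l, m, η, rfl⟩ := t.exists_sum
  have h1 : ∀ x, ∑ i, e x (m i) • η i = 0 := fun x => by
    refine LinearMap.ext fun v => ?_
    simpa [LinearMap.sum_apply, map_sum, hf] using h0 x v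
  have h2 : ∀ k, ∑ i, op (p (tmul _ (η i) (realForm lam (α k)))) • m i = 0 := fun k => by
    refine hinj _ fun x => ?_
    have := congrArg (fun θ => p (tmul _ θ (realForm lam (α k)))) (h1 x)
    simpa only [sum_tmul, map_sum, zero_tmul, map_zero, H.pair_smul_left, he] using this
  calc ∑ i, tmul (ProdAlg R lam) (m i) (η i)
      = ∑ i, tmul (ProdAlg R lam) (m i)
          (∑ k, p (tmul _ (η i) (realForm lam (α k))) • realForm lam (β k)) := by
        simp only [H.left]
    _ = ∑ k, tmul (ProdAlg R lam) (∑ i, op (p (tmul _ (η i) (realForm lam (α k)))) • m i)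
          (realForm lam (β k)) := by
        simp only [tmul_sum, sum_tmul, tmul_balanced]
        exact Finset.sum_comm
    _ = 0 := by simp [h2, zero_tmul]

theorem tensor_ext {t t' : BTensor (ProdAlg R lam) (ProdForm R lam) (ProdForm R lam)}
    (h : ∀ v w, evalTensor lam v w t = evalTensor lam v w t') : t = t' := by
  rw [← sub_eq_zero]
  refine H.tensor_eq_zero _ (E := ProdVec R)
    (fun v => AddMonoidHom.mk' (fun θ : ProdForm R lam => θ v) (fun _ _ => rfl))
    (fun _ _ _ => rfl) (fun θ hθ => LinearMap.ext hθ) (fun v w => evalTensor lam v w)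
    (fun _ _ _ _ => rfl) (fun v w => by rw [map_sub, h, sub_self])

theorem tensor₃_eq_zero {t : BTensor (ProdAlg R lam)
      (BTensor (ProdAlg R lam) (ProdForm R lam) (ProdForm R lam)) (ProdForm R lam)}
    (h : ∀ u v w, evalTensor₃ lam u v w t = 0) : t = 0 :=
  H.tensor_eq_zero _ (E := ProdVec R × ProdVec R)
    (fun x => evalTensor lam x.1 x.2)
    (fun _ _ _ => evalTensor_op_smul _ _ _ _)
    (fun _ hθ => H.tensor_ext fun v w => by rw [hθ (v, w), map_zero])
    (fun x w => evalTensor₃ lam x.1 x.2 w)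
    (fun _ _ _ _ => rfl) (fun x w => h _ _ w)

end IsMetricFrame

/-- The 2-tensor with given coefficients. -/
def tensorOf (α β : ι → Module.Dual R (ProdVec R))
    {p : BTensor (ProdAlg R lam) (ProdForm R lam) (ProdForm R lam) →+ ProdAlg R lam}
    (H : IsMetricFrame lam α β p) (B : ProdVec R →ₗ[R] ProdVec R →ₗ[R] ProdAlg R lam) :
    BTensor (ProdAlg R lam) (ProdForm R lam) (ProdForm R lam) :=
  ∑ k, tmul (ProdAlg R lam)
    ({ toFun := fun u => p (tmul _ (B u) (realForm lam (α k)))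
       map_add' := fun u v => by rw [map_add, add_tmul, map_add]
       map_smul' := fun r u => by
        rw [map_smul, ← algebraMap_smul_form, H.pair_smul_left, RingHom.id_apply,
          Algebra.smul_def] } : ProdForm R lam) (realForm lam (β k))

/-- For fixed `v` this is the expansion of the 1-form `B v` in the `β_k`. -/
theorem evalTensor_tensorOf (α β : ι → Module.Dual R (ProdVec R))
    {p : BTensor (ProdAlg R lam) (ProdForm R lam) (ProdForm R lam) →+ ProdAlg R lam}
    (H : IsMetricFrame lam α β p) (B : ProdVec R →ₗ[R] ProdVec R →ₗ[R] ProdAlg R lam)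
    (v w : ProdVec R) : evalTensor lam v w (tensorOf α β H B) = B v w := by
  rw [H.apply_eq_left (B v) w, tensorOf, map_sum]
  rfl

end

section

variable {R : Type*} [CommRing R] [Algebra ℝ R] {lam : ℝ}

/-! ### The Koszul formula -/

theorem bracket_swap (v w : ProdVec R) : bracket v w = -bracket w v := by
  have h := bracket_self (v + w)
  rw [bracket_add_left, bracket_add_right, bracket_add_right, bracket_self, bracket_self,
    zero_add, add_zero] at h
  exact eq_neg_of_add_eq_zero_left h

/-- Twice the right-hand side of the Koszul formula. -/
def koszulForm (G : ProdVec R →ₗ[R] Module.Dual R (ProdVec R)) (hG : ∀ v w, G v w = G w v)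
    (u v : ProdVec R) : Module.Dual R (ProdVec R) where
  toFun w := u.1 (G v w) + v.1 (G u w) - w.1 (G u v) + G (bracket u v) w - G (bracket u w) v
    - G (bracket v w) u
  map_add' w w' := by
    simp only [map_add, bracket_add_right, LinearMap.add_apply, Prod.fst_add, Derivation.coe_add,
      Pi.add_apply]
    ring
  map_smul' r w := by
    simp only [map_add, map_smul, bracket_smul_right, LinearMap.add_apply, LinearMap.smul_apply,
      Prod.smul_fst, Derivation.coe_smul, Pi.smul_apply, smul_eq_mul, Derivation.leibniz,
      -- Symmetry of `G` is needed for linearity in `w`: the derivatives of `r` produced by the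
      -- brackets cancel those of the first two terms only after exchanging arguments.
      RingHom.id_apply, hG w]
    ring

variable (G : ProdVec R →ₗ[R] Module.Dual R (ProdVec R)) (hG : ∀ v w, G v w = G w v)

theorem koszulForm_apply (u v w : ProdVec R) : koszulForm G hG u v w
    = u.1 (G v w) + v.1 (G u w) - w.1 (G u v) + G (bracket u v) w - G (bracket u w) v
      - G (bracket v w) u := rfl

theorem koszulForm_add_left (u u' v : ProdVec R) :
    koszulForm G hG (u + u') v = koszulForm G hG u v + koszulForm G hG u' v := by
  refine LinearMap.ext fun w => ?_
  simp only [koszulForm_apply, map_add, bracket_add_left, LinearMap.add_apply, Prod.fst_add,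
    Derivation.coe_add, Pi.add_apply]
  ring

theorem koszulForm_smul_left (r : R) (u v : ProdVec R) :
    koszulForm G hG (r • u) v = r • koszulForm G hG u v := by
  refine LinearMap.ext fun w => ?_
  simp only [koszulForm_apply, map_sub, map_smul, bracket_smul_left, LinearMap.sub_apply,
    LinearMap.smul_apply, Prod.smul_fst, Derivation.coe_smul, Pi.smul_apply, smul_eq_mul,
    Derivation.leibniz]
  ring

theorem koszulForm_add_right (u v v' : ProdVec R) :
    koszulForm G hG u (v + v') = koszulForm G hG u v + koszulForm G hG u v' := by
  refine LinearMap.ext fun w => ?_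
  simp only [koszulForm_apply, map_add, bracket_add_right, bracket_add_left, LinearMap.add_apply,
    Prod.fst_add, Derivation.coe_add, Pi.add_apply]
  ring

/-- The Leibniz rule of `∇_u` in the guise of `2𝔤(∇_u v, ·)`. -/
theorem koszulForm_smul_right (r : R) (u v : ProdVec R) :
    koszulForm G hG u (r • v) = r • koszulForm G hG u v + (2 * u.1 r) • G v := by
  refine LinearMap.ext fun w => ?_
  simp only [koszulForm_apply, map_sub, map_add, map_smul, bracket_smul_right, bracket_smul_left,
    LinearMap.sub_apply, LinearMap.add_apply,
    LinearMap.smul_apply, Prod.smul_fst, Derivation.coe_smul, Pi.smul_apply, smul_eq_mul,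
    Derivation.leibniz, hG v u]
  ring

/-- This identity encodes vanishing torsion. -/
theorem koszulForm_sub_swap (u v : ProdVec R) :
    koszulForm G hG u v - koszulForm G hG v u = (2 : R) • G (bracket u v) := by
  refine LinearMap.ext fun w => ?_
  simp only [koszulForm_apply, LinearMap.sub_apply, LinearMap.smul_apply, smul_eq_mul,
    bracket_swap v u, map_neg, LinearMap.neg_apply, hG v u]
  ring

/-- This identity encodes metric compatibility. -/
theorem koszulForm_add_swap (u v w : ProdVec R) :
    koszulForm G hG u v w + koszulForm G hG u w v = 2 * u.1 (G v w) := by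
  simp only [koszulForm_apply, bracket_swap w v, map_neg, LinearMap.neg_apply, hG w v]
  ring

/-! ### The Levi-Civita connection -/

namespace IsMetricFrame

variable {ι : Type*} [Fintype ι] {α β : ι → Module.Dual R (ProdVec R)}
  {p : BTensor (ProdAlg R lam) (ProdForm R lam) (ProdForm R lam) →+ ProdAlg R lam}
  (H : IsMetricFrame lam α β p)

include H

theorem pair_smul (r : R) (θ η : ProdForm R lam) : p (tmul _ (r • θ) η) = r • p (tmul _ θ η) := by
  rw [← algebraMap_smul_form, H.pair_smul_left, Algebra.smul_def]

/-- The Levi-Civita connection on the coefficients of a 1-form. -/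
def lcBilin (θ : ProdForm R lam) : ProdVec R →ₗ[R] ProdVec R →ₗ[R] ProdAlg R lam :=
  LinearMap.mk₂ R (fun u v => act lam u (θ v)
      - (1 / 2 : ℝ) • p (tmul _ (realForm lam (koszulForm (frameForm α β) H.symm u v)) θ))
    (fun u u' v => by
      simp only [koszulForm_add_left, map_add, act_add, add_tmul, smul_add]
      abel)
    (fun r u v => by
      simp only [koszulForm_smul_left, map_smul, act_smul, H.pair_smul, smul_sub,
        smul_comm r (1 / 2 : ℝ)])
    (fun u v v' => by
      simp only [koszulForm_add_right, map_add, add_tmul, smul_add]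
      abel)
    -- The term `u(r) θ(v)` from the derivation cancels `½ (2 u(r) 𝔤(v, ·), θ)`, so the expression
    -- is tensorial in `v`.
    (fun r u v => by
      simp only [koszulForm_smul_right, map_smul, map_add, add_tmul, act_smul_right, H.pair_smul,
        H.pair_frameForm, smul_add, smul_sub, smul_comm r (1 / 2 : ℝ), mul_smul, two_smul]
      rw [← add_smul]
      norm_num
      abel)

theorem lcBilin_apply (θ : ProdForm R lam) (u v : ProdVec R) : H.lcBilin θ u v = act lam u (θ v)
    - (1 / 2 : ℝ) • p (tmul _ (realForm lam (koszulForm (frameForm α β) H.symm u v)) θ) := rfl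

/-- The Levi-Civita connection of a metric with a frame. -/
def lcConnection : ProdConnection R lam where
  nabla := AddMonoidHom.mk' (fun θ => tensorOf α β H (H.lcBilin θ)) (fun θ θ' =>
    H.tensor_ext fun u v => by
      simp only [map_add, evalTensor_tensorOf, lcBilin_apply, LinearMap.add_apply, tmul_add,
        smul_add]
      abel)
  -- The braiding transposes coefficients. With it the extra term `θ(v) u(a)` of the right Leibniz
  -- rule is `(θ ⊗ da)(v, u)`, as required.
  sigma := AddMonoidHom.mk' (fun t => tensorOf α β H (evalBilin t).flip) (fun t t' =>
    H.tensor_ext fun u v => by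
      simp only [map_add, evalTensor_tensorOf, LinearMap.flip_apply, evalBilin_apply])
  sigma_bimodule := ⟨fun a t => H.tensor_ext fun u v => by
      simp only [AddMonoidHom.mk'_apply, evalTensor_tensorOf, LinearMap.flip_apply,
        evalBilin_apply, evalTensor_smul],
    fun a t => H.tensor_ext fun u v => by
      simp only [AddMonoidHom.mk'_apply, evalTensor_tensorOf, LinearMap.flip_apply,
        evalBilin_apply, evalTensor_op_smul]⟩
  leibniz_left a θ := H.tensor_ext fun u v => by
    simp only [AddMonoidHom.mk'_apply, evalTensor_tensorOf, lcBilin_apply, map_add,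
      evalTensor_smul, evalTensor_tmul, form_smul_apply, act_mul, H.pair_realForm_smul, mul_sub,
      mul_smul_comm]
    change _ = _ + act lam u a * θ v
    abel
  leibniz_right a θ := H.tensor_ext fun u v => by
    simp only [AddMonoidHom.mk'_apply, evalTensor_tensorOf, lcBilin_apply, map_add,
      LinearMap.flip_apply, evalBilin_apply,
      evalTensor_op_smul, evalTensor_tmul, form_op_smul_apply, act_mul, H.pair_smul_right, sub_mul,
      smul_mul_assoc]
    change _ = _ + θ v * act lam u a
    abel

theorem eval_lcConnection_nabla (θ : ProdForm R lam) (u v : ProdVec R) :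
    evalTensor lam u v (H.lcConnection.nabla θ) = act lam u (θ v)
      - (1 / 2 : ℝ) • p (tmul _ (realForm lam (koszulForm (frameForm α β) H.symm u v)) θ) :=
  evalTensor_tensorOf α β H _ u v

theorem eval_lcConnection_sigma
    (t : BTensor (ProdAlg R lam) (ProdForm R lam) (ProdForm R lam)) (u v : ProdVec R) :
    evalTensor lam u v (H.lcConnection.sigma t) = evalTensor lam v u t :=
  evalTensor_tensorOf α β H _ u v

end IsMetricFrame

/-! ### Metric compatibility, torsion and `†` in terms of coefficients -/

/-- Evaluation of `(σ ⊗ id)(θ ⊗ t)` when `σ` is the transposition. -/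
theorem evalTensor₃_sigmaAct (D : ProdConnection R lam)
    (hσ : ∀ t u v, evalTensor lam u v (D.sigma t) = evalTensor lam v u t) (θ : ProdForm R lam)
    (t : BTensor (ProdAlg R lam) (ProdForm R lam) (ProdForm R lam)) (u v w : ProdVec R) :
    evalTensor₃ lam u v w (D.sigmaAct θ t) = θ v * evalTensor lam u w t := by
  induction t using BTensor.induction_on with
  | zero => simp
  | tmul ζ η =>
    change evalTensor lam u v (D.sigma (tmul _ θ ζ)) * η w = _
    rw [hσ, evalTensor_tmul, evalTensor_tmul, mul_assoc]
  | add x y hx hy => simp only [map_add, hx, hy, mul_add]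

theorem evalTensor₃_nablaTensor (D : ProdConnection R lam)
    (hσ : ∀ t u v, evalTensor lam u v (D.sigma t) = evalTensor lam v u t)
    (θ η : ProdForm R lam) (u v w : ProdVec R) :
    evalTensor₃ lam u v w (D.nablaTensor (tmul _ θ η))
      = evalTensor lam u v (D.nabla θ) * η w + θ v * evalTensor lam u w (D.nabla η) := by
  rw [← evalTensor₃_sigmaAct D hσ]
  change evalTensor₃ lam u v w (tmul _ (D.nabla θ) η + D.sigmaAct θ (D.nabla η)) = _
  rw [map_add, evalTensor₃_tmul]

theorem eval_prodWedge (t : BTensor (ProdAlg R lam) (ProdForm R lam) (ProdForm R lam))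
    (u v : ProdVec R) :
    (prodWedge R lam t).1 u v = evalTensor lam u v t - evalTensor lam v u t := by
  induction t using BTensor.induction_on with
  | zero => simp
  | tmul θ η => rfl
  | add x y hx hy =>
    simp only [map_add]
    change (prodWedge R lam x).1 u v + (prodWedge R lam y).1 u v = _
    rw [hx, hy]
    abel

theorem eval_prodDagger (t : BTensor (ProdAlg R lam) (ProdForm R lam) (ProdForm R lam))
    (u v : ProdVec R) :
    evalTensor lam u v (prodDagger R lam t) = prodStar lam (evalTensor lam v u t) := by
  induction t using BTensor.induction_on with
  | zero => simp
  | tmul θ η => exact (prodStar_mul lam (θ v) (η u)).symm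
  | add x y hx hy => simp only [map_add, hx, hy]

theorem prodStar_real_smul (r : ℝ) (a : ProdAlg R lam) :
    prodStar lam (r • a) = r • prodStar lam a := by
  rw [← algebraMap_smul R r a, prodStar_smul, algebraMap_smul]

theorem isTorsionFree_iff (D : ProdConnection R lam) :
    D.IsTorsionFree (prodWedge R lam) (prodD₁ R lam) ↔ ∀ (θ : ProdForm R lam) (u v : ProdVec R),
      evalTensor lam u v (D.nabla θ) - evalTensor lam v u (D.nabla θ)
        = act lam u (θ v) - act lam v (θ u) - θ (bracket u v) := by
  refine forall_congr' fun θ => ?_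
  rw [sub_eq_zero]
  constructor
  · intro h u v
    rw [← eval_prodWedge, h]
    rfl
  · intro h
    refine Subtype.ext (LinearMap.ext₂ fun u v => ?_)
    rw [eval_prodWedge, h]
    rfl

/-! ### Existence and uniqueness of the quantum Levi-Civita connection -/

namespace IsMetricFrame

variable {ι : Type*} [Fintype ι] {α β : ι → Module.Dual R (ProdVec R)}
  {p : BTensor (ProdAlg R lam) (ProdForm R lam) (ProdForm R lam) →+ ProdAlg R lam}
  (H : IsMetricFrame lam α β p)

include H

theorem lcConnection_isTorsionFree :
    H.lcConnection.IsTorsionFree (prodWedge R lam) (prodD₁ R lam) := by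
  rw [isTorsionFree_iff]
  intro θ u v
  have h := congrArg (fun η => p (tmul _ (realForm lam η) θ))
    (koszulForm_sub_swap (frameForm α β) H.symm u v)
  simp only [map_sub, sub_tmul, map_smul, H.pair_smul, H.pair_frameForm] at h
  rw [eval_lcConnection_nabla, eval_lcConnection_nabla, sub_sub_sub_comm, ← smul_sub, h,
    two_smul, ← two_smul ℝ, smul_smul]
  norm_num

theorem pair_frameForm_right (η : Module.Dual R (ProdVec R)) (v : ProdVec R) :
    p (tmul _ (realForm lam η) (realForm lam (frameForm α β v))) = algebraMap R _ (η v) := by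
  rw [← realForm_apply, H.apply_eq_left, H.frameForm_eq']
  simp only [map_sum, map_smul, tmul_sum]
  refine Finset.sum_congr rfl fun k _ => ?_
  rw [← algebraMap_smul_form, H.pair_smul_realForm]

theorem lcConnection_isMetricCompatible : H.lcConnection.IsMetricCompatible
    (∑ k, tmul _ (realForm lam (α k)) (realForm lam (β k))) := by
  refine H.tensor₃_eq_zero fun u v w => ?_
  -- The coefficient of `∇𝔤` at `(u, v, w)` is `u(𝔤(v, w)) - ½ C(u, v)(w) - ½ C(u, w)(v)`. Here `e1`
  -- and `e2` expand the two Koszul terms over the frame, `e3` expands `u(𝔤(v, w))` by the product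
  -- rule, and `e4` is the identity between them.
  have e1 := (H.apply_eq_left (realForm lam (koszulForm (frameForm α β) H.symm u v)) w).symm
  have e2 := H.pair_frameForm_right (koszulForm (frameForm α β) H.symm u w) v
  have e3 := congrArg (fun r => algebraMap R (ProdAlg R lam) (u.1 r)) (frameForm_apply α β v w)
  have e4 := congrArg (algebraMap R (ProdAlg R lam))
    (koszulForm_add_swap (frameForm α β) H.symm u v w)
  simp only [frameForm_eq, map_sum, map_smul, tmul_sum, ← algebraMap_smul_form (lam := lam),
    H.pair_smul_realForm] at e2
  simp only [map_sum, Derivation.leibniz, smul_eq_mul, map_add, map_mul,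
    Finset.sum_add_distrib] at e3
  rw [map_add, ← realForm_apply (koszulForm _ _ u v) w, ← e1, ← e2, map_mul, map_ofNat, e3] at e4
  have c : ∀ (r : R) (a : ProdAlg R lam), algebraMap R _ r * a = a * algebraMap R _ r :=
    fun r a => Algebra.commutes r a
  simp only [map_sum, evalTensor₃_nablaTensor _ H.eval_lcConnection_sigma,
    eval_lcConnection_nabla, realForm_apply, act_algebraMap, sub_mul, mul_sub, smul_mul_assoc,
    mul_smul_comm, Finset.sum_add_distrib, Finset.sum_sub_distrib, ← Finset.smul_sum]
  simp only [c _ (p _)]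
  have half : ∀ x : ProdAlg R lam, (1 / 2 : ℝ) • (2 * x) = x := fun x => by
    rw [two_mul, ← two_smul ℝ, smul_smul]
    norm_num
  rw [sub_add_sub_comm, ← smul_add, e4, half]
  simp only [← map_mul, mul_comm (u.1 _)]
  abel

theorem lcConnection_isFlipOnBasis : IsFlipOnBasis lam H.lcConnection := by
  -- For real forms the coefficients commute, so transposing coefficients is the same as exchanging
  -- the factors.
  have key : ∀ α' β' : Module.Dual R (ProdVec R), H.lcConnection.sigma
      (tmul _ (realForm lam α') (realForm lam β')) = tmul _ (realForm lam β') (realForm lam α') :=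
    fun α' β' => H.tensor_ext fun u v => by
      rw [eval_lcConnection_sigma, evalTensor_tmul, evalTensor_tmul]
      exact Algebra.commutes (R := R) (α' v) (algebraMap R (ProdAlg R lam) (β' u))
  have real : ∀ θ : ProdForm R lam,
      ((∃ ω', θ = baseForm lam ω') ∨ ∃ i, θ = fiberForm R lam i) → ∃ η, θ = realForm lam η := by
    rintro _ (⟨ω', rfl⟩ | ⟨i, rfl⟩)
    exacts [⟨_, rfl⟩, ⟨_, rfl⟩]
  intro θ η hθ hη
  obtain ⟨θ, rfl⟩ := real θ hθ
  obtain ⟨η, rfl⟩ := real η hη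
  exact key θ η

theorem pair_star (η : Module.Dual R (ProdVec R)) (θ : ProdForm R lam) :
    p (tmul _ (realForm lam η) (formStar lam θ))
      = prodStar lam (p (tmul _ (realForm lam η) θ)) := by
  have hs : ∀ (a : ProdAlg R lam) (θ : ProdForm R lam),
      formStar lam (a • θ) = op (prodStar lam a) • formStar lam θ :=
    fun a θ => LinearMap.ext fun v => prodStar_mul lam a (θ v)
  have hs2 : formStar lam (formStar lam θ) = θ :=
    LinearMap.ext fun v => prodStar_prodStar (θ v)
  have hs3 : ∀ η' : Module.Dual R (ProdVec R), formStar lam (realForm lam η') = realForm lam η' :=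
    fun η' => LinearMap.ext fun v => prodStar_algebraMap (η' v)
  -- Two conjugations make `θ ↦ (η, θ) - (η, θ^*)^*` left linear, and it vanishes on `𝔤(v, ·)` since
  -- `(η, 𝔤(v, ·)) = η(v)` is real. It is then applied to `θ^*`.
  have h := H.eq_zero_of_frameForm
    (d := (p.comp (tmulHom (realForm lam η)))
      - (prodStar lam).comp ((p.comp (tmulHom (realForm lam η))).comp (formStar lam)))
    (fun a θ => by
      simp only [AddMonoidHom.sub_apply, AddMonoidHom.comp_apply, tmulHom_apply, hs,
        H.pair_smul_right, H.pair_realForm_smul, prodStar_mul, prodStar_prodStar, mul_sub])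
    (fun v => by
      simp only [AddMonoidHom.sub_apply, AddMonoidHom.comp_apply, tmulHom_apply, hs3,
        H.pair_frameForm_right, prodStar_algebraMap, sub_self]) (formStar lam θ)
  simp only [AddMonoidHom.sub_apply, AddMonoidHom.comp_apply, tmulHom_apply, hs2] at h
  exact sub_eq_zero.1 h

theorem lcConnection_isStarPreserving : IsStarPreserving lam H.lcConnection := fun θ =>
  H.tensor_ext fun u v => by
    rw [eval_lcConnection_sigma, eval_prodDagger, eval_lcConnection_nabla,
      eval_lcConnection_nabla, map_sub, ← act_prodStar, H.pair_star, prodStar_real_smul]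
    rfl

/-- The `β_k` span all forms, and a real form splits along `ProdVec R = VecField R × (Fin 3 → R)`
into a form on `M` and a combination of the `s^i`. -/
theorem span_basis : Submodule.span (ProdAlg R lam)
    {θ : ProdForm R lam | (∃ ζ, θ = baseForm lam ζ) ∨ ∃ i, θ = fiberForm R lam i} = ⊤ := by
  refine Submodule.eq_top_iff'.2 fun θ => ?_
  have real : ∀ η : Module.Dual R (ProdVec R), realForm lam η ∈ Submodule.span (ProdAlg R lam)
      {θ : ProdForm R lam | (∃ ζ, θ = baseForm lam ζ) ∨ ∃ i, θ = fiberForm R lam i} := by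
    intro η
    have h : realForm lam η = baseForm lam (η ∘ₗ LinearMap.inl R _ _)
        + ∑ i, algebraMap R (ProdAlg R lam) (η (0, Pi.single i 1)) • fiberForm R lam i := by
      refine LinearMap.ext fun v => ?_
      have hv : v = (v.1, 0) + ∑ i, v.2 i • ((0, Pi.single i 1) : ProdVec R) := by
        refine Prod.ext (by simp [Prod.fst_sum]) (funext fun i => ?_)
        simp [Prod.snd_sum, Pi.single_apply]
      conv_lhs => rw [hv]
      simp only [map_add, map_sum, map_smul, LinearMap.add_apply, LinearMap.sum_apply,
        form_smul_apply, realForm_apply]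
      congr 1
      refine Finset.sum_congr rfl fun i _ => ?_
      change _ = algebraMap R (ProdAlg R lam) _ * algebraMap R (ProdAlg R lam) (v.2 i)
      rw [Algebra.smul_def, Algebra.commutes]
    rw [h]
    exact Submodule.add_mem _ (Submodule.subset_span (Or.inl ⟨_, rfl⟩))
      (Submodule.sum_mem _ fun i _ =>
        Submodule.smul_mem _ _ (Submodule.subset_span (Or.inr ⟨i, rfl⟩)))
  rw [← H.left θ]
  exact Submodule.sum_mem _ fun k _ => Submodule.smul_mem _ _ (real _)

/-- A braiding which is the flip on the basis is the transposition. -/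
theorem eval_sigma_of_isFlipOnBasis {D : ProdConnection R lam} (hD : IsFlipOnBasis lam D)
    (t : BTensor (ProdAlg R lam) (ProdForm R lam) (ProdForm R lam)) (u v : ProdVec R) :
    evalTensor lam u v (D.sigma t) = evalTensor lam v u t := by
  induction t using BTensor.induction_on with
  | zero => simp
  | add x y hx hy => simp only [map_add, hx, hy]
  | tmul θ η =>
    -- A scalar in front of `η` is absorbed by `θ` across the tensor sign, so `θ` is kept general;
    -- one in front of `θ` leaves by left linearity of the braiding.
    have hη : η ∈ Submodule.span _ _ := H.span_basis ▸ Submodule.mem_top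
    induction hη using Submodule.span_induction generalizing θ with
    | zero => simp [tmul_zero]
    | add x y _ _ hx hy => simp only [map_add, tmul_add, hx, hy]
    | smul a x _ hx => rw [← tmul_balanced, hx]
    | mem η hη =>
      have hθ : θ ∈ Submodule.span _ _ := H.span_basis ▸ Submodule.mem_top
      induction hθ using Submodule.span_induction with
      | zero => simp [zero_tmul]
      | add x y _ _ hx hy => simp only [map_add, add_tmul, hx, hy]
      | smul a x _ hx =>
        rw [← BTensor.smul_tmul, D.sigma_bimodule.1, evalTensor_smul, hx, evalTensor_smul]
      | mem θ hθ =>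
        rw [hD θ η hθ hη, evalTensor_tmul, evalTensor_tmul]
        rcases hη with ⟨ζ, rfl⟩ | ⟨i, rfl⟩
        · exact Algebra.commutes (ζ u.1) (θ v)
        · exact Algebra.commutes (u.2 i) (θ v)

/-- Torsion-free metric compatible connections with the same flip braiding agree. -/
theorem connection_ext {D D' : ProdConnection R lam}
    (hσ : ∀ t u v, evalTensor lam u v (D.sigma t) = evalTensor lam v u t)
    (hσ' : ∀ t u v, evalTensor lam u v (D'.sigma t) = evalTensor lam v u t)
    (hT : D.IsTorsionFree (prodWedge R lam) (prodD₁ R lam))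
    (hT' : D'.IsTorsionFree (prodWedge R lam) (prodD₁ R lam))
    (hC : D.IsMetricCompatible (∑ k, tmul _ (realForm lam (α k)) (realForm lam (β k))))
    (hC' : D'.IsMetricCompatible (∑ k, tmul _ (realForm lam (α k)) (realForm lam (β k)))) :
    D = D' := by
  let K : ProdVec R → ProdVec R → ProdForm R lam →+ ProdAlg R lam :=
    fun u v => (evalTensor lam u v).comp (D.nabla - D'.nabla)
  -- The terms `da ⊗ θ` of the two Leibniz rules cancel in the difference.
  have hK : ∀ u v (a : ProdAlg R lam) θ, K u v (a • θ) = a * K u v θ := fun u v a θ => by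
    simp only [K, AddMonoidHom.comp_apply, AddMonoidHom.sub_apply, D.leibniz_left,
      D'.leibniz_left, add_sub_add_right_eq_sub, ← smul_sub, evalTensor_smul]
  let k : ProdVec R → ProdVec R → ProdVec R → ProdAlg R lam :=
    fun u v w => K u v (realForm lam (frameForm α β w))
  have hsym : ∀ u v w, k u v w = k v u w := fun u v w => by
    have h := (isTorsionFree_iff D).1 hT (realForm lam (frameForm α β w)) u v
    have h' := (isTorsionFree_iff D').1 hT' (realForm lam (frameForm α β w)) u v
    simp only [k, K, AddMonoidHom.comp_apply, AddMonoidHom.sub_apply, map_sub]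
    rw [← sub_eq_zero]
    rw [← sub_eq_zero.2 (h.trans h'.symm)]
    abel
  have hanti : ∀ u v w, k u v w = -k u w v := fun u v w => by
    have h := congrArg (evalTensor₃ lam u v w) (hC.trans hC'.symm)
    simp only [map_sum, evalTensor₃_nablaTensor D hσ, evalTensor₃_nablaTensor D' hσ',
      Finset.sum_add_distrib] at h
    have e1 : k u v w = ∑ i, K u v (realForm lam (α i)) * algebraMap R _ (β i w) := by
      simp only [k, H.frameForm_eq', map_sum, map_smul]
      refine Finset.sum_congr rfl fun i _ => ?_
      rw [← algebraMap_smul_form, hK, Algebra.commutes]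
    have e2 : k u w v = ∑ i, algebraMap R _ (α i v) * K u w (realForm lam (β i)) := by
      simp only [k, frameForm_eq, map_sum, map_smul]
      refine Finset.sum_congr rfl fun i _ => ?_
      rw [← algebraMap_smul_form, hK]
    rw [eq_neg_iff_add_eq_zero, e1, e2]
    simp only [K, AddMonoidHom.comp_apply, AddMonoidHom.sub_apply, map_sub, sub_mul, mul_sub,
      Finset.sum_sub_distrib]
    rw [sub_add_sub_comm, sub_eq_zero]
    exact h
  have hk : ∀ u v w, k u v w = 0 := fun u v w => by
    -- Alternating the two symmetries uses three sign changes to return to the starting order.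
    have h : k u v w = -k u v w := by
      calc k u v w = -k u w v := hanti _ _ _
        _ = -k w u v := by rw [hsym u w]
        _ = k w v u := by rw [hanti w u v, neg_neg]
        _ = k v w u := hsym _ _ _
        _ = -k v u w := hanti _ _ _
        _ = -k u v w := by rw [hsym v u]
    have h2 : (2 : ℝ) • k u v w = 0 := by
      rw [two_smul]
      exact eq_neg_iff_add_eq_zero.1 h
    exact (smul_eq_zero_iff_right two_ne_zero).1 h2
  have hn : D.nabla = D'.nabla := AddMonoidHom.ext fun θ => H.tensor_ext fun u v => by
    have := H.eq_zero_of_frameForm (hK u v) (hk u v) θ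
    simpa [K, sub_eq_zero] using this
  have hs : D.sigma = D'.sigma := AddMonoidHom.ext fun t => H.tensor_ext fun u v => by
    rw [hσ, hσ']
  cases D
  cases D'
  -- The remaining fields are proofs, so equality of the two maps suffices.
  simp only at hn hs
  subst hn hs
  rfl

theorem eq_lcConnection {D : ProdConnection R lam}
    (hQ : D.IsQLC (prodWedge R lam) (prodD₁ R lam)
      (∑ k, tmul _ (realForm lam (α k)) (realForm lam (β k))))
    (hF : IsFlipOnBasis lam D) : D = H.lcConnection :=
  H.connection_ext (H.eval_sigma_of_isFlipOnBasis hF) H.eval_lcConnection_sigma hQ.1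
    H.lcConnection_isTorsionFree hQ.2 H.lcConnection_isMetricCompatible

end IsMetricFrame

end

section

/-! ### The fuzzy sphere is not trivial -/

namespace FuzzySphere

/-- Raising operator of the Verma module of highest weight `a / 2`. -/
def vermaRaise (a : ℂ) : Module.End ℂ (ℕ → ℂ) where
  toFun f n := (n + 1) * (a - n) * f (n + 1)
  map_add' f f' := by ext n; simp [mul_add]
  map_smul' c f := by ext n; simp; ring

/-- Lowering operator of the Verma modules. -/
def vermaLower : Module.End ℂ (ℕ → ℂ) where
  toFun f n := n.casesOn 0 f
  map_add' f f' := by ext n; cases n <;> simp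
  map_smul' c f := by ext n; cases n <;> simp

/-- Twice the weight operator of the Verma module of highest weight `a / 2`. -/
def vermaWeight (a : ℂ) : Module.End ℂ (ℕ → ℂ) where
  toFun f n := (a - 2 * n) * f n
  map_add' f f' := by ext n; simp [mul_add]
  map_smul' c f := by ext n; simp; ring

theorem vermaRaise_mul_lower (a : ℂ) : vermaRaise a * vermaLower
    = vermaLower * vermaRaise a + vermaWeight a := by
  ext f n
  cases n <;> simp [vermaRaise, vermaLower, vermaWeight]
  ring

theorem vermaWeight_mul_raise (a : ℂ) : vermaWeight a * vermaRaise a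
    = vermaRaise a * vermaWeight a + (2 : ℂ) • vermaRaise a := by
  ext f n
  simp [vermaRaise, vermaWeight]
  ring

theorem vermaWeight_mul_lower (a : ℂ) : vermaWeight a * vermaLower
    = vermaLower * vermaWeight a - (2 : ℂ) • vermaLower := by
  ext f n
  cases n <;> simp [vermaLower, vermaWeight]
  ring

/-- Sequences are formal combinations of weight vectors. The `sl₂` Casimir is the scalar `a (a + 2)`
for every complex `a`, so no integrality of the weight is needed. -/
theorem verma_casimir (a : ℂ) : (2 : ℂ) • (vermaRaise a * vermaLower + vermaLower * vermaRaise a)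
    + vermaWeight a * vermaWeight a = algebraMap ℂ _ (a * (a + 2)) := by
  ext f n
  cases n <;> simp [vermaRaise, vermaLower, vermaWeight, Algebra.algebraMap_eq_smul_one] <;> ring

/-- The action of the generators of the fuzzy sphere on a Verma module. -/
def vermaGen (l a : ℂ) : Fin 3 → Module.End ℂ (ℕ → ℂ) :=
  ![l • (vermaRaise a + vermaLower), (-Complex.I * l) • (vermaRaise a - vermaLower),
    l • vermaWeight a]

theorem vermaGen_comm (l a : ℂ) (i j : Fin 3) :
    vermaGen l a i * vermaGen l a j - vermaGen l a j * vermaGen l a i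
      = ∑ k, (2 * Complex.I * l * (eps i j k : ℂ)) • vermaGen l a k := by
  have h1 := vermaRaise_mul_lower a
  have h2 := vermaWeight_mul_raise a
  have h3 := vermaWeight_mul_lower a
  fin_cases i <;> fin_cases j <;>
    simp only [vermaGen, eps, Fin.sum_univ_three, mul_add, add_mul, mul_sub, sub_mul, h1, h2, h3,
      smul_mul_smul_comm, Fin.zero_eta, Fin.mk_one, Fin.reduceFinMk, Matrix.cons_val] <;>
    norm_num [smul_smul] <;>
    match_scalars <;> ring_nf <;> simp [Complex.I_sq]

theorem vermaGen_casimir {l a : ℂ} (ha : l * (a + 1) = 1) :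
    ∑ i, vermaGen l a i * vermaGen l a i = algebraMap ℂ _ (1 - l ^ 2) := by
  have h : (1 : ℂ) - l ^ 2 = l ^ 2 * (a * (a + 2)) := by
    linear_combination (-1 - l * (a + 1)) * ha
  rw [h, map_mul, ← verma_casimir, ← Algebra.smul_def]
  simp only [vermaGen, Fin.sum_univ_three, mul_add, add_mul, mul_sub, sub_mul,
    smul_mul_smul_comm, Matrix.cons_val]
  match_scalars <;> ring_nf <;> simp [Complex.I_sq] <;> ring

/-- The relations hold on the completed Verma module with `λ (a + 1) = 1`: then `λ² a (a + 2) = 1 -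
λ²`. A ring that maps to a nonzero ring is nonzero. -/
theorem nontrivial {lam : ℝ} (hlam : lam ≠ 0) : Nontrivial (FuzzySphere lam) := by
  have hl : (lam : ℂ) ≠ 0 := Complex.ofReal_ne_zero.2 hlam
  let f : FuzzySphere lam →ₐ[ℂ] Module.End ℂ (ℕ → ℂ) := RingQuot.liftAlgHom ℂ
    ⟨FreeAlgebra.lift ℂ (vermaGen lam ((lam : ℂ)⁻¹ - 1)), by
      rintro _ _ (⟨i, j⟩ | _)
      · simp only [map_sub, map_mul, map_sum, map_smul, FreeAlgebra.lift_ι_apply]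
        exact vermaGen_comm _ _ i j
      · simp only [map_mul, map_sum, AlgHom.commutes, FreeAlgebra.lift_ι_apply]
        exact vermaGen_casimir (by field_simp; ring)⟩
  exact f.toRingHom.domain_nontrivial

end FuzzySphere

/-! ### Frames of the product metric -/

variable {R : Type*} [CommRing R] [Algebra ℝ R] {lam : ℝ}

/-- The real bilinear form on `ProdVec R` defined by `g`, `A` and `h`. -/
def metricVal (g : OneForm R ⊗[R] OneForm R) (A : Fin 3 → OneForm R)
    (h : Matrix (Fin 3) (Fin 3) R) (v w : ProdVec R) : R :=
  TensorProduct.dualDistrib R (VecField R) (VecField R) g (v.1 ⊗ₜ[R] w.1)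
    + ∑ i, (A i v.1 * w.2 i + v.2 i * A i w.1) + ∑ i, ∑ j, h i j * v.2 i * w.2 j

theorem dualDistrib_comm (g : OneForm R ⊗[R] OneForm R) (X Y : VecField R) :
    TensorProduct.dualDistrib R (VecField R) (VecField R) (TensorProduct.comm R _ _ g)
        (X ⊗ₜ[R] Y)
      = TensorProduct.dualDistrib R (VecField R) (VecField R) g (Y ⊗ₜ[R] X) := by
  induction g using TensorProduct.induction_on with
  | zero => simp
  | tmul a b => simp [mul_comm]
  | add x y hx hy => simp only [map_add, LinearMap.add_apply, hx, hy]

theorem metricVal_symm {g : OneForm R ⊗[R] OneForm R} (hg : TensorProduct.comm R _ _ g = g)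
    (A : Fin 3 → OneForm R) {h : Matrix (Fin 3) (Fin 3) R} (hh : h.IsSymm) (v w : ProdVec R) :
    metricVal g A h v w = metricVal g A h w v := by
  unfold metricVal
  conv_lhs => rw [← hg, dualDistrib_comm]
  congr 1
  · congr 1
    exact Finset.sum_congr rfl fun i _ => by ring
  · rw [Finset.sum_comm]
    exact Finset.sum_congr rfl fun i _ => Finset.sum_congr rfl fun j _ => by
      rw [hh.apply]; ring

theorem exists_sum_tmul (g : OneForm R ⊗[R] OneForm R) :
    ∃ (k : ℕ) (a b : Fin k → OneForm R), g = ∑ i, a i ⊗ₜ[R] b i := by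
  induction g using TensorProduct.induction_on with
  | zero => exact ⟨0, 0, 0, by simp⟩
  | tmul m n => exact ⟨1, fun _ => m, fun _ => n, by simp⟩
  | add x y hx hy =>
    obtain ⟨k, m, n, rfl⟩ := hx
    obtain ⟨l, m', n', rfl⟩ := hy
    exact ⟨k + l, Fin.append m m', Fin.append n n', by simp [Fin.sum_univ_add]⟩

/-- A real 1-form on `M` on `ProdVec R`. -/
def baseDual (ζ : OneForm R) : Module.Dual R (ProdVec R) :=
  ζ ∘ₗ LinearMap.fst R (VecField R) (Fin 3 → R)

variable (R) in
/-- The form `s^i` on `ProdVec R`. -/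
def fiberDual (i : Fin 3) : Module.Dual R (ProdVec R) :=
  LinearMap.proj i ∘ₗ LinearMap.snd R (VecField R) (Fin 3 → R)

theorem realForm_baseDual (ζ : OneForm R) : realForm lam (baseDual ζ) = baseForm lam ζ := rfl

theorem realForm_fiberDual (i : Fin 3) : realForm lam (fiberDual R i) = fiberForm R lam i := rfl

theorem exists_frame (lam : ℝ) (g : OneForm R ⊗[R] OneForm R) (A : Fin 3 → OneForm R)
    (h : Matrix (Fin 3) (Fin 3) R) :
    ∃ (ι : Type) (_ : Fintype ι) (α β : ι → Module.Dual R (ProdVec R)),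
      prodMetric lam g A h = ∑ k, tmul _ (realForm lam (α k)) (realForm lam (β k)) ∧
      ∀ v w, frameForm α β v w = metricVal g A h v w := by
  obtain ⟨N, a, b, rfl⟩ := exists_sum_tmul g
  -- The indices list the terms of `g`, the terms `A_i ⊗ s^i`, the terms `s^i ⊗ A_i`, and the terms
  -- `h_{ij} s^i ⊗ s^j`, with `h_{ij}` put into the first factor.
  refine ⟨(Fin N ⊕ (Fin 3 ⊕ Fin 3)) ⊕ (Fin 3 × Fin 3), inferInstance,
    Sum.elim (Sum.elim (fun k => baseDual (a k))
      (Sum.elim (fun i => baseDual (A i)) (fiberDual R))) (fun x => h x.1 x.2 • fiberDual R x.1),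
    Sum.elim (Sum.elim (fun k => baseDual (b k))
      (Sum.elim (fiberDual R) (fun i => baseDual (A i)))) (fun x => fiberDual R x.2), ?_, ?_⟩
  · simp only [prodMetric, Fintype.sum_sum_type, Fintype.sum_prod_type, Sum.elim_inl, Sum.elim_inr,
      map_sum, map_smul, realForm_baseDual, realForm_fiberDual, Finset.sum_add_distrib]
    refine congrArg₂ _ rfl (Finset.sum_congr rfl fun i _ => Finset.sum_congr rfl fun j _ => ?_)
    rw [BTensor.smul_tmul, algebraMap_smul_form]
  · intro v w
    simp only [frameForm_apply, metricVal, Fintype.sum_sum_type, Fintype.sum_prod_type,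
      Sum.elim_inl, Sum.elim_inr, map_sum, LinearMap.sum_apply, Finset.sum_add_distrib]
    rfl

theorem isMetricFrame_of_isMetricInverse {ι : Type*} [Fintype ι]
    {α β : ι → Module.Dual R (ProdVec R)}
    {p : BTensor (ProdAlg R lam) (ProdForm R lam) (ProdForm R lam) →+ ProdAlg R lam}
    (hs : ∀ v w, frameForm α β v w = frameForm α β w v)
    (hp : IsMetricInverse (∑ k, tmul _ (realForm lam (α k)) (realForm lam (β k))) p) :
    IsMetricFrame lam α β p := by
  obtain ⟨hb, hp⟩ := hp
  refine ⟨hs, hb, fun θ => ?_, fun θ => ?_⟩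
  · have := (hp θ).1
    rw [map_sum] at this
    exact this
  · have := (hp θ).2
    rw [map_sum] at this
    exact this

end

section

/-! ### Locality and evaluation at a point -/

section Eval

variable {n : ℕ} {M : Type*} [TopologicalSpace M] [ChartedSpace (EuclideanSpace ℝ (Fin n)) M]

namespace Smooth

theorem add_apply (f f' : Smooth n M) (p : M) : (f + f') p = f p + f' p := rfl

theorem sub_apply (f f' : Smooth n M) (p : M) : (f - f') p = f p - f' p := rfl

theorem mul_apply (f f' : Smooth n M) (p : M) : (f * f') p = f p * f' p := rfl

theorem zero_apply (p : M) : (0 : Smooth n M) p = 0 := rfl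

theorem one_apply (p : M) : (1 : Smooth n M) p = 1 := rfl

variable (n) in
/-- Evaluation at a point as a ring homomorphism. -/
def ev (p : M) : Smooth n M →+* ℝ := ContMDiffMap.evalRingHom p

theorem sum_apply {ι : Type*} (s : Finset ι) (f : ι → Smooth n M) (p : M) :
    (∑ i ∈ s, f i) p = ∑ i ∈ s, f i p :=
  map_sum (ev n p) f s

theorem intCast_apply (k : ℤ) (p : M) : (k : Smooth n M) p = k := map_intCast (ev n p) k

theorem derivation_mul_apply (X : VecField (Smooth n M)) (f f' : Smooth n M) (p : M) :
    X (f * f') p = X f p * f' p + f p * X f' p := by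
  rw [X.leibniz, add_apply, smul_eq_mul, smul_eq_mul, mul_apply, mul_apply]
  ring

theorem inv_apply {h : Matrix (Fin 3) (Fin 3) (Smooth n M)} (hh : IsUnit h.det) (p : M) :
    (Matrix.of fun i j => h i j p)⁻¹ = Matrix.of fun i j => h⁻¹ i j p := by
  refine Matrix.inv_eq_right_inv ?_
  have := congrArg (ev n p).mapMatrix (Matrix.mul_nonsing_inv h hh)
  rwa [map_mul, map_one] at this

theorem det_apply_ne_zero {h : Matrix (Fin 3) (Fin 3) (Smooth n M)} (hh : IsUnit h.det) (p : M) :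
    (Matrix.of fun i j => h i j p).det ≠ 0 := by
  have := (hh.map (ev n p)).ne_zero
  rwa [RingHom.map_det] at this

theorem exists_bump [IsManifold (𝓡 n) ∞ M] [T2Space M] [SecondCountableTopology M]
    (U : TopologicalSpace.Opens M) {p : M} (hp : p ∈ U) :
    ∃ χ : Smooth n M, χ p = 1 ∧ ∀ q ∉ U, χ q = 0 := by
  -- With second countability this gives the σ-compactness used by the smooth Urysohn lemma.
  have : LocallyCompactSpace M := ChartedSpace.locallyCompactSpace (EuclideanSpace ℝ (Fin n)) M
  obtain ⟨χ, h0, h1, -⟩ := exists_contMDiffMap_zero_one_of_isClosed (𝓡 n) (n := ⊤)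
    U.isOpen.isClosed_compl (isClosed_singleton (x := p)) (by simpa using hp)
  exact ⟨χ, h1 rfl, fun q hq => h0 hq⟩

variable [IsManifold (𝓡 n) ∞ M] [T2Space M] [SecondCountableTopology M]
  {U : TopologicalSpace.Opens M} {p : M}

/-- Derivations are local: apply the product rule at `p` to `χ (f - f') = 0`, with a bump function
`χ` supported in `U`. -/
theorem derivation_congr (X : VecField (Smooth n M)) {f f' : Smooth n M} (hp : p ∈ U)
    (h : ∀ q ∈ U, f q = f' q) : X f p = X f' p := by
  obtain ⟨χ, h1, h0⟩ := exists_bump (n := n) U hp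
  have hχ : χ * (f - f') = 0 := by
    ext q
    rw [mul_apply, sub_apply, zero_apply]
    by_cases hq : q ∈ U
    · rw [h q hq, sub_self, mul_zero]
    · rw [h0 q hq, zero_mul]
  have := derivation_mul_apply X χ (f - f') p
  rw [hχ, map_zero, map_sub, sub_apply, sub_apply, h p hp, h1, zero_apply] at this
  linarith

/-- `C^∞(M)`-linear maps are local. -/
theorem linear_local {V : Type*} [AddCommGroup V] [Module (Smooth n M) V]
    {W : Type*} [AddCommGroup W] [Module (Smooth n M) W]
    {E : Type*} [AddCommGroup E] [Module ℝ E] (L : V →ₗ[Smooth n M] W) (e : W → E)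
    (he : ∀ (f : Smooth n M) w, e (f • w) = f p • e w)
    (hp : p ∈ U) {v : V} (hv : ∀ χ : Smooth n M, (∀ q ∉ U, χ q = 0) → χ • v = 0) :
    e (L v) = 0 := by
  obtain ⟨χ, h1, h0⟩ := exists_bump (n := n) U hp
  have h := he χ (L v)
  rw [← map_smul, hv χ h0, map_zero, h1, one_smul] at h
  have h2 := he 0 0
  rw [zero_smul, zero_apply, zero_smul] at h2
  rw [← h, h2]

end Smooth

theorem evalAt_smul (lam : ℝ) (p : M) (f : Smooth n M) (a : ProdAlg (Smooth n M) lam) :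
    evalAt lam p (f • a) = f p • evalAt lam p a := by
  induction a using TensorProduct.induction_on with
  | zero => simp
  | add x y hx hy => simp only [smul_add, map_add, hx, hy]
  | tmul f' c =>
    rw [TensorProduct.smul_tmul']
    change (f p * f' p) • c = f p • f' p • c
    rw [mul_smul]

theorem evalAt_algebraMap (lam : ℝ) (p : M) (f : Smooth n M) :
    evalAt lam p (algebraMap (Smooth n M) (ProdAlg (Smooth n M) lam) f)
      = algebraMap ℝ (FuzzySphere lam) (f p) := by
  rw [Algebra.algebraMap_eq_smul_one, evalAt_smul, Algebra.algebraMap_eq_smul_one]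
  congr 1
  change (1 : ℝ) • (1 : FuzzySphere lam) = 1
  rw [one_smul]

end Eval

/-! ### Coordinate frames -/

theorem IsMetricFrame.pair_realForm_sub_sum {R κ : Type*} [CommRing R] [Algebra ℝ R] {lam : ℝ}
    [Fintype κ] {ι : Type*} [Fintype ι] {α β : ι → Module.Dual R (ProdVec R)}
    {p : BTensor (ProdAlg R lam) (ProdForm R lam) (ProdForm R lam) →+ ProdAlg R lam}
    (H : IsMetricFrame lam α β p) (C η : Module.Dual R (ProdVec R))
    (x : κ → R) (ζ : κ → Module.Dual R (ProdVec R)) :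
    p (tmul _ (realForm lam C) (realForm lam η))
      = p (tmul _ (realForm lam C) (realForm lam (η - ∑ b, x b • ζ b)))
        + ∑ b, x b • p (tmul _ (realForm lam C) (realForm lam (ζ b))) := by
  conv_lhs => rw [← sub_add_cancel η (∑ b, x b • ζ b)]
  rw [map_add, tmul_add, map_add, map_sum, tmul_sum, map_sum]
  congr 1
  refine Finset.sum_congr rfl fun b _ => ?_
  rw [map_smul, ← algebraMap_smul_form, H.pair_realForm_smul, Algebra.smul_def]

theorem IsMetricFrame.smul_pair_realForm {R : Type*} [CommRing R] [Algebra ℝ R] {lam : ℝ}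
    {ι : Type*} [Fintype ι] {α β : ι → Module.Dual R (ProdVec R)}
    {p : BTensor (ProdAlg R lam) (ProdForm R lam) (ProdForm R lam) →+ ProdAlg R lam}
    (H : IsMetricFrame lam α β p) (C : Module.Dual R (ProdVec R)) {η : Module.Dual R (ProdVec R)}
    {r : R} (hr : r • η = 0) : r • p (tmul _ (realForm lam C) (realForm lam η)) = 0 := by
  rw [Algebra.smul_def, ← H.pair_realForm_smul, algebraMap_smul_form, ← map_smul, hr, map_zero,
    tmul_zero, map_zero]

theorem smul_sub_sum_apply {R ι : Type*} [CommRing R] [Algebra ℝ R] [Fintype ι]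
    (r : R) (η : Module.Dual R (ProdVec R)) (x : ι → R) (ζ : ι → Module.Dual R (ProdVec R))
    (v : ProdVec R) :
    (r • (η - ∑ b, x b • ζ b)) v = r * (η v - ∑ b, x b * ζ b v) := by
  simp [LinearMap.sum_apply]

namespace LocalCoordinates

variable {n : ℕ} {M : Type*} [TopologicalSpace M] [ChartedSpace (EuclideanSpace ℝ (Fin n)) M]
variable (c : LocalCoordinates n M)

/-- The derivations `∂_μ` and `∂_i` over a coordinate patch. -/
def vec : Fin n ⊕ Fin 3 → ProdVec (Smooth n M) := Sum.elim c.e (f n M)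

/-- The forms `dx^μ` and `s^i`. -/
def covec : Fin n ⊕ Fin 3 → Module.Dual (Smooth n M) (ProdVec (Smooth n M)) :=
  Sum.elim (fun μ => baseDual (dBase (c.x μ))) (fiberDual (Smooth n M))

theorem covec_vec (a b : Fin n ⊕ Fin 3) {q : M} (hq : q ∈ c.domain) :
    c.covec a (c.vec b) q = if a = b then 1 else 0 := by
  rcases a with μ | i <;> rcases b with ν | j
  · change c.del ν (c.x μ) q = _
    rw [c.del_x ν μ q hq]
    simp [eq_comm]
  · rfl
  · rfl
  · change (Pi.single j 1 : Fin 3 → Smooth n M) i q = _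
    by_cases h : i = j
    · subst h; simp [Smooth.one_apply]
    · simp [h, Smooth.zero_apply]

variable [IsManifold (𝓡 n) ∞ M] [T2Space M] [SecondCountableTopology M]

/-- The derivation `X - ∑ X(x^μ) ∂_μ` vanishes over the patch but perhaps not outside, so it is
killed by every cutoff and locality applies. -/
theorem oneForm_apply (ζ : OneForm (Smooth n M)) (X : VecField (Smooth n M)) {p : M}
    (hp : p ∈ c.domain) : ζ X p = ∑ μ, X (c.x μ) p * ζ (c.del μ) p := by
  have h : ζ (X - ∑ μ, X (c.x μ) • c.del μ) p = 0 := by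
    refine Smooth.linear_local ζ (fun f => f p) (fun _ _ => rfl) hp fun χ hχ => ?_
    refine Derivation.ext fun f' => ContMDiffMap.ext fun q => ?_
    have e1 : (χ • (X - ∑ μ, X (c.x μ) • c.del μ)) f'
        = χ * (X f' - ∑ μ, X (c.x μ) * c.del μ f') := by
      have := congrFun (map_sum (Derivation.coeFnAddMonoidHom (R := ℝ) (A := Smooth n M)
        (M := Smooth n M)) (fun μ => X (c.x μ) • c.del μ) Finset.univ) f'
      rw [Finset.sum_apply] at this
      exact congrArg (fun y => χ * (X f' - y)) this
    rw [e1, Smooth.mul_apply]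
    by_cases hq : q ∈ c.domain
    · rw [Smooth.sub_apply, Smooth.sum_apply, c.expand X f' q hq]
      simp [Smooth.mul_apply, Smooth.zero_apply]
    · rw [hχ q hq, zero_mul]; rfl
  rw [map_sub, map_sum, Smooth.sub_apply, Smooth.sum_apply, sub_eq_zero] at h
  rw [h]
  refine Finset.sum_congr rfl fun μ _ => ?_
  rw [map_smul]
  rfl

theorem form_apply (η : Module.Dual (Smooth n M) (ProdVec (Smooth n M)))
    (v : ProdVec (Smooth n M)) {p : M} (hp : p ∈ c.domain) :
    η v p = ∑ a, η (c.vec a) p * c.covec a v p := by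
  have hv : v = (v.1, 0) + ∑ i, v.2 i • f n M i := by
    refine Prod.ext (by simp [f, Prod.fst_sum]) (funext fun i => ?_)
    simp [f, Prod.snd_sum, Pi.single_apply]
  have h1 := c.oneForm_apply (η ∘ₗ LinearMap.inl _ _ _) v.1 hp
  conv_lhs => rw [hv]
  rw [map_add, map_sum, Smooth.add_apply, Smooth.sum_apply, Fintype.sum_sum_type]
  congr 1
  · refine h1.trans (Finset.sum_congr rfl fun μ _ => mul_comm _ _)
  · refine Finset.sum_congr rfl fun i _ => ?_
    rw [map_smul, smul_eq_mul, Smooth.mul_apply, mul_comm]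
    rfl

/-- The extended coordinate fields commute only over the patch. There `∂_ν x^ρ` is constant, so
`[∂_μ, ∂_ν]` kills the coordinates, which determine the value at `p`. -/
theorem bracket_apply (η : Module.Dual (Smooth n M) (ProdVec (Smooth n M))) (μ ν : Fin n) {p : M}
    (hp : p ∈ c.domain) : η (bracket (c.e μ) (c.e ν)) p = 0 := by
  have hb : bracket (c.e μ) (c.e ν) = (⁅c.del μ, c.del ν⁆, 0) :=
    Prod.ext rfl (funext fun i => by simp [bracket, e])
  have h := c.oneForm_apply (η ∘ₗ LinearMap.inl _ _ _) ⁅c.del μ, c.del ν⁆ hp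
  rw [hb]
  refine h.trans (Finset.sum_eq_zero fun ρ _ => ?_)
  have h2 : ∀ μ ν, c.del μ (c.del ν (c.x ρ)) p = 0 := fun μ ν => by
    have := Smooth.derivation_congr (c.del μ) (f := c.del ν (c.x ρ))
      (f' := if ν = ρ then 1 else 0) hp (fun q hq => by
        rw [c.del_x ν ρ q hq]; split_ifs <;> rfl)
    rw [this]
    split_ifs <;> simp [Smooth.zero_apply]
  rw [Derivation.commutator_apply, Smooth.sub_apply, h2, h2, sub_zero, zero_mul]

variable {lam : ℝ} {ι : Type*} [Fintype ι]
  {α β : ι → Module.Dual (Smooth n M) (ProdVec (Smooth n M))}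
  {P : BTensor (ProdAlg (Smooth n M) lam) (ProdForm (Smooth n M) lam)
    (ProdForm (Smooth n M) lam) →+ ProdAlg (Smooth n M) lam}
  (H : IsMetricFrame lam α β P)

/-- The matrix of a metric in a coordinate frame. -/
def gram (α β : ι → Module.Dual (Smooth n M) (ProdVec (Smooth n M))) (p : M) :
    Matrix (Fin n ⊕ Fin 3) (Fin n ⊕ Fin 3) ℝ :=
  Matrix.of fun a b => frameForm α β (c.vec a) (c.vec b) p

include H

/-- A cutoff kills the difference of `η` and its coordinate expansion, so only the values of `η` on
the frame at `p` count. -/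
theorem evalAt_pair (C η : Module.Dual (Smooth n M) (ProdVec (Smooth n M))) {p : M}
    (hp : p ∈ c.domain) : evalAt lam p (P (tmul _ (realForm lam C) (realForm lam η)))
      = ∑ b, η (c.vec b) p •
          evalAt lam p (P (tmul _ (realForm lam C) (realForm lam (c.covec b)))) := by
  have h : evalAt lam p (P (tmul _ (realForm lam C)
      (realForm lam (η - ∑ b, η (c.vec b) • c.covec b)))) = 0 := by
    obtain ⟨χ, h1, h0⟩ := Smooth.exists_bump (n := n) c.domain hp
    rw [← one_smul ℝ (evalAt lam p _), ← h1, ← evalAt_smul, H.smul_pair_realForm, map_zero]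
    refine LinearMap.ext fun v => ContMDiffMap.ext fun q => ?_
    have e1 := smul_sub_sum_apply χ η (fun b => η (c.vec b)) c.covec v
    refine (congrArg (fun y : Smooth n M => y q) e1).trans ?_
    rw [Smooth.mul_apply]
    by_cases hq : q ∈ c.domain
    · rw [Smooth.sub_apply, Smooth.sum_apply, c.form_apply η v hq]
      simp only [Smooth.mul_apply, sub_self, mul_zero]
      rfl
    · rw [h0 q hq, zero_mul]; rfl
  rw [H.pair_realForm_sub_sum C η (fun b => η (c.vec b)) c.covec, map_add, h, zero_add, map_sum]
  refine Finset.sum_congr rfl fun b _ => ?_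
  rw [evalAt_smul]

/-- Expand `𝔤(e_a, ·)` in coordinates inside `(C, 𝔤(e_a, ·)) = C(e_a)`. This is the linear system
for the coefficients. -/
theorem sum_gram_smul (C : Module.Dual (Smooth n M) (ProdVec (Smooth n M))) {p : M}
    (hp : p ∈ c.domain) (a : Fin n ⊕ Fin 3) :
    ∑ b, c.gram α β p a b • evalAt lam p (P (tmul _ (realForm lam C) (realForm lam (c.covec b))))
      = algebraMap ℝ _ (C (c.vec a) p) := by
  rw [← evalAt_algebraMap, ← H.pair_frameForm_right, c.evalAt_pair H _ _ hp]
  rfl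

theorem isUnit_gram (hlam : lam ≠ 0) {p : M} (hp : p ∈ c.domain) :
    IsUnit (c.gram α β p) := by
  have := FuzzySphere.nontrivial hlam
  -- The pairings of the coframe invert the matrix but have values in the fuzzy sphere. A real
  -- functional that is nonzero on `1`, normalised, turns them into a real inverse.
  obtain ⟨φ, hφ⟩ : ∃ φ : Module.Dual ℝ (FuzzySphere lam), φ 1 ≠ 0 := by
    by_contra! h
    exact one_ne_zero ((Module.forall_dual_apply_eq_zero_iff ℝ (1 : FuzzySphere lam)).1 h)
  let Q : Matrix (Fin n ⊕ Fin 3) (Fin n ⊕ Fin 3) ℝ := Matrix.of fun b a => (φ 1)⁻¹ *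
    φ (evalAt lam p (P (tmul _ (realForm lam (c.covec a)) (realForm lam (c.covec b)))))
  have hQ : c.gram α β p * Q = 1 := by
    ext a b
    have h := congrArg φ (c.sum_gram_smul H (c.covec b) hp a)
    rw [Algebra.algebraMap_eq_smul_one, map_smul, c.covec_vec b a hp] at h
    simp only [map_sum, map_smul, smul_eq_mul] at h
    simp only [Matrix.mul_apply, Q, Matrix.of_apply, Matrix.one_apply]
    simp only [mul_left_comm _ (φ 1)⁻¹, ← Finset.mul_sum, h, eq_comm (a := b)]
    rw [mul_left_comm, inv_mul_cancel₀ hφ, mul_one]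
  exact IsUnit.of_mul_eq_one Q hQ

/-- The system has real matrix and right-hand side. The difference from a real solution is a
fuzzy-sphere-valued solution of the homogeneous system, and the real inverse matrix kills it. -/
theorem evalAt_pair_eq (hlam : lam ≠ 0) {p : M} (hp : p ∈ c.domain)
    (C : Module.Dual (Smooth n M) (ProdVec (Smooth n M))) (r : Fin n ⊕ Fin 3 → ℝ)
    (hr : ∀ a, ∑ b, c.gram α β p a b * r b = C (c.vec a) p) (b : Fin n ⊕ Fin 3) :
    evalAt lam p (P (tmul _ (realForm lam C) (realForm lam (c.covec b))))
      = algebraMap ℝ _ (r b) := by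
  have hinv := Matrix.nonsing_inv_mul (c.gram α β p)
    ((Matrix.isUnit_iff_isUnit_det _).1 (c.isUnit_gram H hlam hp))
  set x : Fin n ⊕ Fin 3 → FuzzySphere lam := fun b =>
    evalAt lam p (P (tmul _ (realForm lam C) (realForm lam (c.covec b)))) - algebraMap ℝ _ (r b)
    with hx
  have h0 : ∀ a, ∑ b, c.gram α β p a b • x b = 0 := fun a => by
    simp only [hx, smul_sub, Finset.sum_sub_distrib, c.sum_gram_smul H C hp, ← hr a, map_sum,
      Algebra.algebraMap_eq_smul_one, smul_smul, sub_self]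
  have h1 : x b = ∑ a, (c.gram α β p)⁻¹ b a • ∑ d, c.gram α β p a d • x d := by
    simp only [Finset.smul_sum, smul_smul]
    rw [Finset.sum_comm]
    simp only [← Finset.sum_smul, ← Matrix.mul_apply, hinv, Matrix.one_apply, ite_smul, one_smul,
      zero_smul, Finset.sum_ite_eq, Finset.mem_univ, if_true]
  simp only [h0, smul_zero, Finset.sum_const_zero] at h1
  exact sub_eq_zero.1 h1

/-- The coefficients of the Levi-Civita connection, from the Koszul formula. -/
theorem hasCoef_lcConnection (hlam : lam ≠ 0) {p : M} (hp : p ∈ c.domain) (u v : Fin n ⊕ Fin 3)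
    (r : Fin n ⊕ Fin 3 → ℝ)
    (hr : ∀ a, ∑ b, c.gram α β p a b * r b
      = -(1 / 2) * koszulForm (frameForm α β) H.symm (c.vec u) (c.vec v) (c.vec a) p)
    (b : Fin n ⊕ Fin 3) :
    HasCoef H.lcConnection (realForm lam (c.covec b)) p (c.vec u) (c.vec v) (r b) := by
  -- The derivative term drops out, as frame and coframe are dual, with constant values, over the
  -- whole patch.
  have h0 : (c.vec u).1 (c.covec b (c.vec v)) p = 0 := by
    rw [Smooth.derivation_congr (c.vec u).1 (f' := if b = v then 1 else 0) hp (fun q hq => by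
      rw [c.covec_vec b v hq]; split_ifs <;> rfl)]
    split_ifs <;> simp [Smooth.zero_apply]
  have h1 := c.evalAt_pair_eq H hlam hp (koszulForm (frameForm α β) H.symm (c.vec u) (c.vec v))
    -- The coefficient `r b` is `-½` times the pairing with `C`, so the pairing is `-2 r b`.
    (fun b => -2 * r b) (fun a => by
      simp only [mul_left_comm _ (-2 : ℝ), ← Finset.mul_sum, hr]
      ring) b
  rw [HasCoef, H.eval_lcConnection_nabla, realForm_apply, act_algebraMap, map_sub, map_smul, h1,
    evalAt_algebraMap, h0, map_zero, zero_sub,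
    Algebra.algebraMap_eq_smul_one, Algebra.algebraMap_eq_smul_one, smul_smul, ← neg_smul]
  congr 1
  ring

end LocalCoordinates

end

section

/-! ### Block linear systems -/

section Blocks

variable {m k : Type*} [Fintype m] [DecidableEq m] [Fintype k] [DecidableEq k]
  {g : Matrix m m ℝ} {B : Matrix m k ℝ} {h : Matrix k k ℝ}

/-- The block determinant is `det h` times that of the Schur complement. -/
theorem det_schur_ne_zero (hU : (Matrix.fromBlocks g B B.transpose h).det ≠ 0) (hh : h.det ≠ 0) :
    (g - B * h⁻¹ * B.transpose).det ≠ 0 := by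
  let _ := h.invertibleOfIsUnitDet (isUnit_iff_ne_zero.2 hh)
  rw [Matrix.det_fromBlocks₂₂, Matrix.invOf_eq_nonsing_inv] at hU
  exact right_ne_zero_of_mul hU

theorem det_schur_ne_zero' (hU : (Matrix.fromBlocks g B B.transpose h).det ≠ 0) (hg : g.det ≠ 0) :
    (h - B.transpose * g⁻¹ * B).det ≠ 0 := by
  let _ := g.invertibleOfIsUnitDet (isUnit_iff_ne_zero.2 hg)
  rw [Matrix.det_fromBlocks₁₁, Matrix.invOf_eq_nonsing_inv] at hU
  exact right_ne_zero_of_mul hU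

/-- Elimination of the second block of unknowns. -/
theorem solve_blocks {x c₁ : m → ℝ} {y c₂ : k → ℝ}
    (h₁ : g.mulVec x + B.mulVec y = c₁) (h₂ : B.transpose.mulVec x + h.mulVec y = c₂)
    (hh : h.det ≠ 0) (hs : (g - B * h⁻¹ * B.transpose).det ≠ 0) :
    x = (g - B * h⁻¹ * B.transpose)⁻¹.mulVec (c₁ - B.mulVec (h⁻¹.mulVec c₂)) ∧
      y = h⁻¹.mulVec (c₂ - B.transpose.mulVec x) := by
  have hy : y = h⁻¹.mulVec (c₂ - B.transpose.mulVec x) := by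
    rw [← h₂, add_sub_cancel_left, Matrix.mulVec_mulVec,
      Matrix.nonsing_inv_mul _ (isUnit_iff_ne_zero.2 hh), Matrix.one_mulVec]
  refine ⟨?_, hy⟩
  have hx : (g - B * h⁻¹ * B.transpose).mulVec x = c₁ - B.mulVec (h⁻¹.mulVec c₂) := by
    rw [← h₁]
    conv_rhs => rw [hy]
    rw [Matrix.mulVec_sub, Matrix.mulVec_sub, Matrix.sub_mulVec, ← Matrix.mulVec_mulVec,
      ← Matrix.mulVec_mulVec]
    abel
  rw [← hx, Matrix.mulVec_mulVec, Matrix.nonsing_inv_mul _ (isUnit_iff_ne_zero.2 hs),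
    Matrix.one_mulVec]

end Blocks

namespace LocalCoordinates

variable {n : ℕ} {M : Type*} [TopologicalSpace M] [ChartedSpace (EuclideanSpace ℝ (Fin n)) M]
variable (c : LocalCoordinates n M)
  {g : OneForm (Smooth n M) ⊗[Smooth n M] OneForm (Smooth n M)}
  {A : Fin 3 → OneForm (Smooth n M)} {h : Matrix (Fin 3) (Fin 3) (Smooth n M)}

/-! ### The metric and its Koszul form in coordinates -/

theorem metricVal_e_e (μ ν : Fin n) : metricVal g A h (c.e μ) (c.e ν) = c.gLo g μ ν := by
  simp [metricVal, e, gLo]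

theorem metricVal_e_f (μ : Fin n) (i : Fin 3) :
    metricVal g A h (c.e μ) (f n M i) = c.ALo A μ i := by
  simp [metricVal, e, f, ALo, Pi.single_apply]

theorem metricVal_f_e (μ : Fin n) (i : Fin 3) :
    metricVal g A h (f n M i) (c.e μ) = c.ALo A μ i := by
  simp [metricVal, e, f, ALo, Pi.single_apply]

theorem metricVal_f_f (i j : Fin 3) :
    metricVal g A h (f n M i) (f n M j) = h i j := by
  simp [metricVal, f, Pi.single_apply]

theorem bracket_e_f (μ : Fin n) (i : Fin 3) : bracket (c.e μ) (f n M i) = 0 := by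
  refine Prod.ext (Derivation.ext fun r => by simp [bracket, f, Derivation.commutator_apply])
    (funext fun k => ?_)
  by_cases hk : k = i
  · subst hk; simp [bracket, e, f]
  · simp [bracket, e, f, hk]

theorem bracket_f_f (i j : Fin 3) :
    bracket (f n M i) (f n M j) = ∑ k, (eps i j k : Smooth n M) • f n M k := by
  refine Prod.ext (by simp [bracket, f, Prod.fst_sum]) (funext fun k => ?_)
  simp [bracket, f, Prod.snd_sum, Pi.single_apply]

variable {G : ProdVec (Smooth n M) →ₗ[Smooth n M] Module.Dual (Smooth n M) (ProdVec (Smooth n M))}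
  (hs : ∀ v w, G v w = G w v) (hG : ∀ v w, G v w = metricVal g A h v w) {p : M}

/-- Since `∂_μ` and `∂_i` commute. Hence `dx^α ⊗ s^i` and `s^i ⊗ dx^α` carry equal coefficients. -/
theorem koszulForm_f_e (μ : Fin n) (i : Fin 3) :
    koszulForm G hs (f n M i) (c.e μ) = koszulForm G hs (c.e μ) (f n M i) := by
  have := koszulForm_sub_swap G hs (c.e μ) (f n M i)
  rw [c.bracket_e_f, map_zero, smul_zero, sub_eq_zero] at this
  exact this.symm

theorem e_fst (μ : Fin n) : (c.e μ).1 = c.del μ := rfl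

theorem f_fst_apply (i : Fin 3) (r : Smooth n M) : (f n M i).1 r = 0 := rfl

include hG

theorem form_bracket_f_f (i j : Fin 3) (w : ProdVec (Smooth n M)) :
    G (bracket (f n M i) (f n M j)) w p = ∑ k, (eps i j k : ℝ) * metricVal g A h (f n M k) w p := by
  rw [bracket_f_f, map_sum, LinearMap.sum_apply, Smooth.sum_apply]
  refine Finset.sum_congr rfl fun k _ => ?_
  rw [map_smul, LinearMap.smul_apply, smul_eq_mul, Smooth.mul_apply, Smooth.intCast_apply, hG]

theorem koszul_e_f_f (μ : Fin n) (i j : Fin 3) :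
    koszulForm G hs (c.e μ) (f n M i) (f n M j) p
      = c.del μ (h i j) p - ∑ l, c.ALo A μ l p * (eps i j l : ℝ) := by
  rw [koszulForm_apply, c.bracket_e_f, c.bracket_e_f, Smooth.sub_apply,
    form_bracket_f_f hG]
  simp only [hG (f n M _) (f n M _), metricVal_f_e, metricVal_f_f, e_fst,
    f_fst_apply, map_zero, LinearMap.zero_apply, add_zero, sub_zero, mul_comm]

theorem koszul_f_f_e (ν : Fin n) (i j : Fin 3) :
    koszulForm G hs (f n M i) (f n M j) (c.e ν) p
      = -c.del ν (h i j) p + ∑ l, (eps i j l : ℝ) * c.ALo A ν l p := by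
  rw [koszulForm_apply, bracket_swap _ (c.e ν), bracket_swap _ (c.e ν), c.bracket_e_f,
    c.bracket_e_f]
  simp only [hG (f n M _) (f n M _), metricVal_f_e, metricVal_f_f, e_fst, f_fst_apply, map_zero,
    neg_zero, LinearMap.zero_apply, add_zero, sub_zero, zero_sub, Smooth.add_apply,
    form_bracket_f_f hG]
  rfl

theorem koszul_f_f_f (i j k : Fin 3) :
    koszulForm G hs (f n M i) (f n M j) (f n M k) p
      = ∑ l, (eps i j l : ℝ) * h l k p - ∑ l, (eps i k l : ℝ) * h l j p
        - ∑ l, (eps j k l : ℝ) * h l i p := by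
  rw [koszulForm_apply]
  simp only [f_fst_apply, add_zero, sub_zero, zero_add, Smooth.sub_apply, form_bracket_f_f hG,
    metricVal_f_f]

variable [IsManifold (𝓡 n) ∞ M] [T2Space M] [SecondCountableTopology M]

theorem koszul_e_e_e (hp : p ∈ c.domain) (μ ν ρ : Fin n) :
    koszulForm G hs (c.e μ) (c.e ν) (c.e ρ) p
      = c.del μ (c.gLo g ν ρ) p + c.del ν (c.gLo g μ ρ) p - c.del ρ (c.gLo g μ ν) p := by
  have hb : ∀ α β w, G (bracket (c.e α) (c.e β)) w p = 0 := fun α β w => by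
    rw [hs]; exact c.bracket_apply (G w) α β hp
  rw [koszulForm_apply]
  simp only [Smooth.sub_apply, Smooth.add_apply, hb, add_zero, sub_zero, hG (c.e _) (c.e _),
    metricVal_e_e, e_fst]

theorem koszul_e_e_f (hp : p ∈ c.domain) (μ ν : Fin n) (i : Fin 3) :
    koszulForm G hs (c.e μ) (c.e ν) (f n M i) p
      = c.del μ (c.ALo A ν i) p + c.del ν (c.ALo A μ i) p := by
  have hb : ∀ α β w, G (bracket (c.e α) (c.e β)) w p = 0 := fun α β w => by
    rw [hs]; exact c.bracket_apply (G w) α β hp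
  rw [koszulForm_apply]
  simp only [Smooth.add_apply, hb, add_zero, sub_zero, hG (c.e _) (f n M _),
    metricVal_e_f, e_fst, f_fst_apply, bracket_e_f, map_zero, LinearMap.zero_apply]

theorem koszul_e_f_e (hp : p ∈ c.domain) (μ ν : Fin n) (i : Fin 3) :
    koszulForm G hs (c.e μ) (f n M i) (c.e ν) p = c.curlA A p μ ν i := by
  have hb : ∀ α β w, G (bracket (c.e α) (c.e β)) w p = 0 := fun α β w => by
    rw [hs]; exact c.bracket_apply (G w) α β hp
  rw [koszulForm_apply, c.bracket_e_f, bracket_swap (f n M i), c.bracket_e_f]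
  simp only [hG (c.e _) (f n M _), hG (f n M _) (c.e _), metricVal_e_f, metricVal_f_e, e_fst,
    f_fst_apply, map_zero, neg_zero, hb,
    LinearMap.zero_apply, add_zero, sub_zero, curlA, Smooth.sub_apply]

end LocalCoordinates

end

section

namespace LocalCoordinates

variable {n : ℕ} {M : Type*} [TopologicalSpace M] [ChartedSpace (EuclideanSpace ℝ (Fin n)) M]
variable (c : LocalCoordinates n M)
  {g : OneForm (Smooth n M) ⊗[Smooth n M] OneForm (Smooth n M)}
  {A : Fin 3 → OneForm (Smooth n M)} {h : Matrix (Fin 3) (Fin 3) (Smooth n M)} {p : M}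

/-! ### Symmetry of the coefficients -/

theorem inv_symm {R : Type*} [CommRing R] {k : Type*} [Fintype k] [DecidableEq k]
    {B : Matrix k k R} (hB : ∀ i j, B i j = B j i) (i j : k) : B⁻¹ i j = B⁻¹ j i := by
  have h : B.transpose = B := Matrix.ext fun i j => hB j i
  conv_lhs => rw [← h, ← Matrix.transpose_nonsing_inv]
  rfl

theorem gLo_symm (hg : TensorProduct.comm (Smooth n M) _ _ g = g) (μ ν : Fin n) :
    c.gLo g μ ν = c.gLo g ν μ := by
  unfold gLo
  conv_lhs => rw [← hg, dualDistrib_comm]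

theorem gtLo_symm (hg : TensorProduct.comm (Smooth n M) _ _ g = g) (hh : h.IsSymm) (μ ν : Fin n) :
    c.gtLo g A h μ ν = c.gtLo g A h ν μ := by
  unfold gtLo
  rw [c.gLo_symm hg, Finset.sum_comm]
  congr 1
  refine Finset.sum_congr rfl fun i _ => Finset.sum_congr rfl fun j _ => ?_
  rw [inv_symm (fun i j => hh.apply j i) j i]
  ring

theorem gUp_symm (hg : TensorProduct.comm (Smooth n M) _ _ g = g) (μ ν : Fin n) :
    c.gUp g p μ ν = c.gUp g p ν μ :=
  inv_symm (fun μ ν => by simp only [Matrix.of_apply, c.gLo_symm hg μ ν]) μ ν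

theorem gtUp_symm (hg : TensorProduct.comm (Smooth n M) _ _ g = g) (hh : h.IsSymm) (μ ν : Fin n) :
    c.gtUp g A h p μ ν = c.gtUp g A h p ν μ :=
  inv_symm (fun μ ν => by simp only [Matrix.of_apply, c.gtLo_symm hg hh μ ν]) μ ν

theorem htLo_symm (hg : TensorProduct.comm (Smooth n M) _ _ g = g) (hh : h.IsSymm) (i j : Fin 3) :
    c.htLo g A h p i j = c.htLo g A h p j i := by
  simp only [htLo, Matrix.of_apply]
  rw [Finset.sum_comm, hh.apply]
  congr 1
  refine Finset.sum_congr rfl fun i _ => Finset.sum_congr rfl fun j _ => ?_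
  rw [c.gUp_symm hg]
  ring

theorem htUp_symm (hg : TensorProduct.comm (Smooth n M) _ _ g = g) (hh : h.IsSymm) (i j : Fin 3) :
    c.htUp g A h p i j = c.htUp g A h p j i :=
  inv_symm (c.htLo_symm hg hh) i j

/-! ### Solving for the coefficients -/

variable (g p) in
/-- The matrix `g_{μν}` at a point. -/
def gMat : Matrix (Fin n) (Fin n) ℝ := Matrix.of fun μ ν => c.gLo g μ ν p

variable (A p) in
/-- The matrix `A_{μi}` at a point. -/
def AMat : Matrix (Fin n) (Fin 3) ℝ := Matrix.of fun μ i => c.ALo A μ i p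

variable (h p) in
/-- The matrix `h_{ij}` at a point. -/
def hMat : Matrix (Fin 3) (Fin 3) ℝ := Matrix.of fun i j => h i j p

theorem hMat_inv (hdet : IsUnit h.det) : (hMat h p)⁻¹ = Matrix.of fun i j => h⁻¹ i j p :=
  Smooth.inv_apply hdet p

theorem gtLo_eq (hdet : IsUnit h.det) : (Matrix.of fun μ ν => c.gtLo g A h μ ν p)
    = c.gMat g p - c.AMat A p * (hMat h p)⁻¹ * (c.AMat A p).transpose := by
  ext μ ν
  rw [hMat_inv hdet]
  simp only [Matrix.of_apply, gtLo, Matrix.sub_apply, Matrix.mul_apply, gMat, AMat,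
    Matrix.transpose_apply, Smooth.sub_apply, Smooth.sum_apply, Smooth.mul_apply, Finset.sum_mul]
  rw [Finset.sum_comm]
  congr 1
  exact Finset.sum_congr rfl fun i _ => Finset.sum_congr rfl fun j _ => by ring

theorem htLo_eq : c.htLo g A h p
    = hMat h p - (c.AMat A p).transpose * (c.gMat g p)⁻¹ * c.AMat A p := by
  ext i j
  simp only [htLo, Matrix.of_apply, Matrix.sub_apply, Matrix.mul_apply, gMat, AMat, hMat,
    Matrix.transpose_apply, Finset.sum_mul, gUp]
  rw [Finset.sum_comm]
  congr 1
  exact Finset.sum_congr rfl fun i _ => Finset.sum_congr rfl fun j _ => by ring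

theorem gram_eq {ι : Type*} [Fintype ι]
    {α β : ι → Module.Dual (Smooth n M) (ProdVec (Smooth n M))}
    (hG : ∀ v w, frameForm α β v w = metricVal g A h v w) : c.gram α β p
      = Matrix.fromBlocks (c.gMat g p) (c.AMat A p) (c.AMat A p).transpose (hMat h p) := by
  ext a b
  rcases a with μ | i <;> rcases b with ν | j <;>
    simp only [gram, Matrix.of_apply, hG, vec, Sum.elim_inl, Sum.elim_inr, metricVal_e_e,
      metricVal_e_f, metricVal_f_e, metricVal_f_f, Matrix.fromBlocks_apply₁₁,
      Matrix.fromBlocks_apply₁₂, Matrix.fromBlocks_apply₂₁, Matrix.fromBlocks_apply₂₂] <;> rfl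

section Solve

variable {r κ : Fin n ⊕ Fin 3 → ℝ}
  (hU : (Matrix.fromBlocks (c.gMat g p) (c.AMat A p) (c.AMat A p).transpose (hMat h p)).det ≠ 0)
  (hr : ∀ a, ∑ b, Matrix.fromBlocks (c.gMat g p) (c.AMat A p) (c.AMat A p).transpose (hMat h p) a b
    * r b = κ a)

include hr

theorem blocks_inl : (c.gMat g p).mulVec (fun μ => r (Sum.inl μ))
    + (c.AMat A p).mulVec (fun i => r (Sum.inr i)) = fun μ => κ (Sum.inl μ) := by
  ext μ
  rw [← hr, Fintype.sum_sum_type]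
  rfl

theorem blocks_inr : (c.AMat A p).transpose.mulVec (fun μ => r (Sum.inl μ))
    + (hMat h p).mulVec (fun i => r (Sum.inr i)) = fun i => κ (Sum.inr i) := by
  ext μ
  rw [← hr, Fintype.sum_sum_type]
  rfl

include hU

theorem solve_inl (hdet : IsUnit h.det) (μ : Fin n) : r (Sum.inl μ)
    = ∑ ν, c.gtUp g A h p μ ν * (κ (Sum.inl ν)
      - ∑ i, c.ALo A ν i p * ∑ j, h⁻¹ i j p * κ (Sum.inr j)) := by
  have hh := Smooth.det_apply_ne_zero hdet p
  have := congrFun (solve_blocks (c.blocks_inl hr) (c.blocks_inr hr) hh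
    (det_schur_ne_zero hU hh)).1 μ
  rw [← c.gtLo_eq hdet, hMat_inv hdet] at this
  exact this

theorem solve_inr (hdet : IsUnit h.det) (k : Fin 3) : r (Sum.inr k)
    = ∑ i, h⁻¹ k i p * (κ (Sum.inr i) - ∑ μ, c.ALo A μ i p * r (Sum.inl μ)) := by
  have hh := Smooth.det_apply_ne_zero hdet p
  have := congrFun (solve_blocks (c.blocks_inl hr) (c.blocks_inr hr) hh
    (det_schur_ne_zero hU hh)).2 k
  rw [hMat_inv hdet] at this
  exact this

/-- The same elimination with the blocks exchanged: inverting `g` rather than `h` makes `h̃` the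
Schur complement. -/
theorem solve_inr' (hg0 : (c.gMat g p).det ≠ 0) (k : Fin 3) : r (Sum.inr k)
    = ∑ i, c.htUp g A h p k i * (κ (Sum.inr i)
      - ∑ μ, c.ALo A μ i p * ∑ ν, c.gUp g p μ ν * κ (Sum.inl ν)) := by
  have hs := det_schur_ne_zero' hU hg0
  have h1 : (hMat h p).mulVec (fun i => r (Sum.inr i))
      + (c.AMat A p).transpose.mulVec (fun μ => r (Sum.inl μ)) = fun i => κ (Sum.inr i) :=
    (add_comm _ _).trans (c.blocks_inr hr)
  have h2 : (c.AMat A p).transpose.transpose.mulVec (fun i => r (Sum.inr i))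
      + (c.gMat g p).mulVec (fun μ => r (Sum.inl μ)) = fun μ => κ (Sum.inl μ) :=
    (add_comm _ _).trans (c.blocks_inl hr)
  have := congrFun (solve_blocks h1 h2 hg0 hs).1 k
  rw [Matrix.transpose_transpose, ← c.htLo_eq] at this
  exact this

end Solve

/-! ### The closed formulas -/

theorem coefΓ_symm (hg : TensorProduct.comm (Smooth n M) _ _ g = g) (hh : h.IsSymm)
    (σ μ ν : Fin n) : c.coefΓ g A h p σ μ ν = c.coefΓ g A h p σ ν μ := by
  have hi : ∀ i j, h⁻¹ i j = h⁻¹ j i := inv_symm (fun i j => hh.apply j i)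
  unfold coefΓ christoffel
  congr 2
  · refine Finset.sum_congr rfl fun ρ _ => ?_
    rw [c.gtLo_symm hg hh μ ν]
    ring
  · refine Finset.sum_congr rfl fun ρ _ => ?_
    congr 1
    congr 1
    · ring
    · rw [Finset.sum_comm]
      refine Finset.sum_congr rfl fun i _ => Finset.sum_congr rfl fun j _ => ?_
      rw [hi j i]
      ring

/-- By the product rule, the derivatives of `A h⁻¹ A` in the Christoffel symbols of `g̃` combine
with the correction terms and leave only the symmetrised derivatives of `A`. -/
theorem coefΓ_eq (hh : h.IsSymm) (σ μ ν : Fin n) : -c.coefΓ g A h p σ μ ν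
    = ∑ ρ, c.gtUp g A h p σ ρ *
      (-(1 / 2) * (c.del μ (c.gLo g ν ρ) p + c.del ν (c.gLo g μ ρ) p - c.del ρ (c.gLo g μ ν) p)
        - ∑ i, c.ALo A ρ i p * ∑ j, h⁻¹ i j p *
          (-(1 / 2) * (c.del μ (c.ALo A ν j) p + c.del ν (c.ALo A μ j) p))) := by
  have hi : ∀ i j, h⁻¹ i j = h⁻¹ j i := inv_symm (fun i j => hh.apply j i)
  rw [coefΓ, christoffel, ← mul_add, ← Finset.sum_add_distrib, ← neg_mul, Finset.mul_sum]
  refine Finset.sum_congr rfl fun ρ _ => ?_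
  rw [← mul_add, mul_left_comm]
  congr 1
  simp only [curlAUp, gtLo, AUp, map_sub, map_add, Smooth.sub_apply, Smooth.add_apply,
    Smooth.derivation_mul_apply, Smooth.mul_apply, Fin.sum_univ_three, hi 1 0, hi 2 0, hi 2 1]
  ring

theorem coefE_eq (hg : TensorProduct.comm (Smooth n M) _ _ g = g) (hh : h.IsSymm)
    (k : Fin 3) (μ ν : Fin n) : c.coefE g A h p k μ ν
    = ∑ i, h⁻¹ k i p * (-(1 / 2) * (c.del μ (c.ALo A ν i) p + c.del ν (c.ALo A μ i) p)
      - ∑ ρ, c.ALo A ρ i p * -c.coefΓ g A h p ρ μ ν) := by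
  rw [coefE, Finset.mul_sum]
  refine Finset.sum_congr rfl fun i _ => ?_
  have e : ∑ ρ, c.ALo A ρ i p * -c.coefΓ g A h p ρ μ ν
      = -∑ ρ, c.coefΓ g A h p ρ μ ν * c.ALo A ρ i p := by
    rw [← Finset.sum_neg_distrib]
    exact Finset.sum_congr rfl fun ρ _ => by ring
  simp only [covA, c.coefΓ_symm hg hh _ ν μ, e]
  ring

theorem coefF_eq (hg : TensorProduct.comm (Smooth n M) _ _ g = g) (hh : h.IsSymm)
    (μ α : Fin n) (i : Fin 3) : c.coefF g A h p μ α i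
    = ∑ ν, c.gtUp g A h p μ ν * (-(1 / 2) * c.curlA A p α ν i
        - ∑ k, c.ALo A ν k p * ∑ j, h⁻¹ k j p *
          (-(1 / 2) * (c.del α (h i j) p - ∑ l, c.ALo A α l p * (eps i j l : ℝ)))) := by
  have hi : ∀ i j, h⁻¹ i j = h⁻¹ j i := inv_symm (fun i j => hh.apply j i)
  rw [coefF, Finset.mul_sum]
  refine Finset.sum_congr rfl fun ν _ => ?_
  rw [mul_left_comm, c.gtUp_symm hg hh ν μ]
  congr 1
  simp only [Fin.sum_univ_three, hi 1 0, hi 2 0, hi 2 1]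
  ring

theorem hEps_eq (i j m : Fin 3) : hEps h p i j m
    = ∑ l, (eps i m l : ℝ) * h l j p + ∑ l, (eps j m l : ℝ) * h l i p := by
  simp only [hEps, Fin.sum_univ_three]
  ring

theorem sum_inv_mul {B C : Matrix (Fin 3) (Fin 3) ℝ} (hBC : B * C = 1) (x : Fin 3 → ℝ) (m : Fin 3) :
    ∑ k, B m k * ∑ l, x l * C k l = x m := by
  have h : ∀ l, ∑ k, B m k * C k l = if m = l then 1 else 0 := fun l => by
    rw [← Matrix.mul_apply, hBC, Matrix.one_apply]
  simp only [Finset.mul_sum]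
  rw [Finset.sum_comm]
  simp only [mul_left_comm _ (x _), ← Finset.mul_sum, h]
  simp

theorem coefD_eq (hh : h.IsSymm) (hdet : IsUnit h.det) (μ : Fin n) (i j : Fin 3) :
    c.coefD g A h p μ i j = ∑ ν, c.gtUp g A h p μ ν *
      (-(1 / 2) * (-c.del ν (h i j) p + ∑ l, (eps i j l : ℝ) * c.ALo A ν l p)
        - ∑ m, c.ALo A ν m p * ∑ k, h⁻¹ m k p *
          (-(1 / 2) * (∑ l, (eps i j l : ℝ) * h l k p - ∑ l, (eps i k l : ℝ) * h l j p
            - ∑ l, (eps j k l : ℝ) * h l i p))) := by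
  have hi : ∀ i j, h⁻¹ i j = h⁻¹ j i := inv_symm (fun i j => hh.apply j i)
  have h1 : (Matrix.of fun i j => h⁻¹ i j p) * hMat h p = 1 := by
    rw [← hMat_inv hdet]
    exact Matrix.nonsing_inv_mul _ (isUnit_iff_ne_zero.2 (Smooth.det_apply_ne_zero hdet p))
  -- This part of the purely fuzzy Koszul term contracts with `h⁻¹` to a bare `ε`, which cancels the
  -- explicit `ε_{ijl} A_{νl}`; only the symmetrised `hEps` survives.
  have h2 : ∀ m, ∑ k, h⁻¹ m k p * ∑ l, (eps i j l : ℝ) * h l k p = eps i j m := fun m => by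
    rw [← sum_inv_mul h1 (fun l => (eps i j l : ℝ)) m]
    simp only [Matrix.of_apply, hMat, hh.apply]
  rw [coefD, Finset.mul_sum]
  refine Finset.sum_congr rfl fun ν _ => ?_
  rw [mul_left_comm]
  congr 1
  have e : ∀ m, ∑ k, h⁻¹ m k p *
        (-(1 / 2) * (∑ l, (eps i j l : ℝ) * h l k p - ∑ l, (eps i k l : ℝ) * h l j p
          - ∑ l, (eps j k l : ℝ) * h l i p))
      = -(1 / 2) * (eps i j m : ℝ) + 1 / 2 * ∑ k, h⁻¹ k m p * hEps h p i j k := fun m => by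
    rw [← h2 m, Finset.mul_sum, Finset.mul_sum, ← Finset.sum_add_distrib]
    refine Finset.sum_congr rfl fun k _ => ?_
    rw [hEps_eq, hi k m]
    ring
  simp only [e]
  simp only [Fin.sum_univ_three]
  ring

theorem coefB_eq (hg : TensorProduct.comm (Smooth n M) _ _ g = g) (hh : h.IsSymm)
    (k : Fin 3) (α : Fin n) (i : Fin 3) : c.coefB g A h p k α i
    = ∑ j, c.htUp g A h p k j *
      (-(1 / 2) * (c.del α (h i j) p - ∑ l, c.ALo A α l p * (eps i j l : ℝ))
        - ∑ μ, c.ALo A μ j p * ∑ ν, c.gUp g p μ ν * (-(1 / 2) * c.curlA A p α ν i)) := by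
  rw [coefB, Finset.mul_sum]
  refine Finset.sum_congr rfl fun j _ => ?_
  rw [mul_left_comm, c.htUp_symm hg hh j k]
  congr 1
  have e : ∑ μ, c.ALo A μ j p * ∑ ν, c.gUp g p μ ν * (-(1 / 2) * c.curlA A p α ν i)
      = -(1 / 2) * ∑ μ, ∑ ν, c.gUp g p μ ν * c.ALo A μ j p * c.curlA A p α ν i := by
    simp only [Finset.mul_sum]
    exact Finset.sum_congr rfl fun i _ => Finset.sum_congr rfl fun j _ => by ring
  rw [e]
  ring

theorem coefH_eq (hg : TensorProduct.comm (Smooth n M) _ _ g = g) (hh : h.IsSymm)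
    (hdet : (c.htLo g A h p).det ≠ 0) (l i k : Fin 3) : c.coefH g A h p l i k
    = ∑ j, c.htUp g A h p l j *
      (-(1 / 2) * (∑ m, (eps i k m : ℝ) * h m j p - ∑ m, (eps i j m : ℝ) * h m k p
            - ∑ m, (eps k j m : ℝ) * h m i p)
        - ∑ μ, c.ALo A μ j p * ∑ ν, c.gUp g p μ ν *
          (-(1 / 2) * (-c.del ν (h i k) p + ∑ m, (eps i k m : ℝ) * c.ALo A ν m p))) := by
  have h1 : c.htUp g A h p * c.htLo g A h p = 1 :=
    Matrix.nonsing_inv_mul _ (isUnit_iff_ne_zero.2 hdet)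
  have hε : eps l i k = eps i k l := by
    revert l i k; decide
  -- The bare `-½ ε` is written as `h̃⁻¹ h̃` applied to `ε`, so that both sides become sums against
  -- `h̃⁻¹`. The `A g⁻¹ A` part of `h̃` then accounts for the `ε A` terms of the elimination.
  rw [coefH, hε, ← sum_inv_mul h1 (fun l => (eps i k l : ℝ)) l, Finset.mul_sum, Finset.mul_sum,
    ← Finset.sum_sub_distrib]
  refine Finset.sum_congr rfl fun j _ => ?_
  rw [c.htUp_symm hg hh j l, mul_left_comm, mul_left_comm (1 / 2 : ℝ) (c.htUp g A h p l j),
    ← mul_sub]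
  congr 1
  have e1 : ∑ μ, c.ALo A μ j p * ∑ ν, c.gUp g p μ ν *
        (-(1 / 2) * (-c.del ν (h i k) p + ∑ m, (eps i k m : ℝ) * c.ALo A ν m p))
      = 1 / 2 * (∑ μ, ∑ ν, c.ALo A μ j p * c.gUp g p μ ν * c.del ν (h i k) p)
        - 1 / 2 * ∑ m, (eps i k m : ℝ) *
            ∑ μ, ∑ ν, c.gUp g p μ ν * c.ALo A μ j p * c.ALo A ν m p := by
    simp only [Fin.sum_univ_three, Finset.mul_sum, ← Finset.sum_add_distrib,
      ← Finset.sum_sub_distrib]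
    exact Finset.sum_congr rfl fun i _ => Finset.sum_congr rfl fun j _ => by ring
  rw [e1, hEps_eq]
  simp only [htLo, Matrix.of_apply, fun m => hh.apply j m, mul_sub, Finset.sum_sub_distrib]
  ring

end LocalCoordinates

end

/-! ### The coefficients of the quantum Levi-Civita connection -/

section

namespace LocalCoordinates

variable {n : ℕ} {M : Type*} [TopologicalSpace M] [ChartedSpace (EuclideanSpace ℝ (Fin n)) M]
  [IsManifold (𝓡 n) ∞ M] [T2Space M] [SecondCountableTopology M] (c : LocalCoordinates n M)
  {g : OneForm (Smooth n M) ⊗[Smooth n M] OneForm (Smooth n M)}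
  {A : Fin 3 → OneForm (Smooth n M)} {h : Matrix (Fin 3) (Fin 3) (Smooth n M)} {p : M}
  {lam : ℝ} {ι : Type*} [Fintype ι]
  {α β : ι → Module.Dual (Smooth n M) (ProdVec (Smooth n M))}
  {P : BTensor (ProdAlg (Smooth n M) lam) (ProdForm (Smooth n M) lam)
    (ProdForm (Smooth n M) lam) →+ ProdAlg (Smooth n M) lam}
  (H : IsMetricFrame lam α β P)

include H

theorem det_blocks_ne_zero (hlam : lam ≠ 0) (hp : p ∈ c.domain)
    (hG : ∀ v w, frameForm α β v w = metricVal g A h v w) :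
    (Matrix.fromBlocks (c.gMat g p) (c.AMat A p) (c.AMat A p).transpose (hMat h p)).det ≠ 0 := by
  rw [← c.gram_eq hG]
  exact isUnit_iff_ne_zero.1 ((Matrix.isUnit_iff_isUnit_det _).1 (c.isUnit_gram H hlam hp))

/-- The coefficients of the Levi-Civita connection solve the Koszul equations. -/
theorem exists_hasCoef (hlam : lam ≠ 0) (hp : p ∈ c.domain)
    (hG : ∀ v w, frameForm α β v w = metricVal g A h v w) (u v : Fin n ⊕ Fin 3) :
    ∃ r : Fin n ⊕ Fin 3 → ℝ,
      (∀ a, ∑ b, Matrix.fromBlocks (c.gMat g p) (c.AMat A p) (c.AMat A p).transpose (hMat h p) a b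
        * r b = -(1 / 2) * koszulForm (frameForm α β) H.symm (c.vec u) (c.vec v) (c.vec a) p) ∧
      ∀ b, HasCoef H.lcConnection (realForm lam (c.covec b)) p (c.vec u) (c.vec v) (r b) := by
  set κ : Fin n ⊕ Fin 3 → ℝ := fun a =>
    -(1 / 2) * koszulForm (frameForm α β) H.symm (c.vec u) (c.vec v) (c.vec a) p
  have hr : (c.gram α β p).mulVec ((c.gram α β p)⁻¹.mulVec κ) = κ := by
    rw [Matrix.mulVec_mulVec, Matrix.mul_nonsing_inv _
      ((Matrix.isUnit_iff_isUnit_det _).1 (c.isUnit_gram H hlam hp)), Matrix.one_mulVec]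
  refine ⟨(c.gram α β p)⁻¹.mulVec κ, fun a => ?_, fun b => ?_⟩
  · rw [← c.gram_eq hG]
    exact congrFun hr a
  · exact c.hasCoef_lcConnection H hlam hp u v _ (fun a => congrFun hr a) b

theorem hasCoefΓFDE (hlam : lam ≠ 0) (hp : p ∈ c.domain)
    (hG : ∀ v w, frameForm α β v w = metricVal g A h v w)
    (hg : TensorProduct.comm (Smooth n M) _ _ g = g) (hh : h.IsSymm) (hdet : IsUnit h.det) :
    c.HasCoefΓFDE g A h p H.lcConnection := by
  have hU := c.det_blocks_ne_zero H hlam hp hG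
  -- Kept separate because back substitution for `E` takes the solved values `-Γ` as input.
  have hΓ : ∀ α' β' σ (r : Fin n ⊕ Fin 3 → ℝ), (∀ a, ∑ b, Matrix.fromBlocks (c.gMat g p)
      (c.AMat A p) (c.AMat A p).transpose (hMat h p) a b * r b = -(1 / 2) *
        koszulForm (frameForm α β) H.symm (c.e α') (c.e β') (c.vec a) p) →
      r (Sum.inl σ) = -c.coefΓ g A h p σ α' β' := fun α' β' σ r hr => by
    rw [c.solve_inl hU hr hdet, c.coefΓ_eq hh]
    simp only [vec, Sum.elim_inl, Sum.elim_inr, c.koszul_e_e_e H.symm hG hp,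
      c.koszul_e_e_f H.symm hG hp]
  refine ⟨fun μ α' β' => ?_, fun μ α' i => ?_, fun μ α' i => ?_, fun μ i j => ?_,
    fun k α' β' => ?_⟩
  · obtain ⟨r, hr, hc⟩ := c.exists_hasCoef H hlam hp hG (Sum.inl α') (Sum.inl β')
    rw [← hΓ α' β' μ r hr]
    exact hc (Sum.inl μ)
  · obtain ⟨r, hr, hc⟩ := c.exists_hasCoef H hlam hp hG (Sum.inl α') (Sum.inr i)
    have e := c.solve_inl hU hr hdet μ
    simp only [vec, Sum.elim_inl, Sum.elim_inr, c.koszul_e_f_e H.symm hG hp,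
      c.koszul_e_f_f H.symm hG] at e
    rw [c.coefF_eq hg hh, ← e]
    exact hc (Sum.inl μ)
  · obtain ⟨r, hr, hc⟩ := c.exists_hasCoef H hlam hp hG (Sum.inr i) (Sum.inl α')
    have e := c.solve_inl hU hr hdet μ
    simp only [vec, Sum.elim_inl, Sum.elim_inr, koszulForm_f_e, c.koszul_e_f_e H.symm hG hp,
      c.koszul_e_f_f H.symm hG] at e
    rw [c.coefF_eq hg hh, ← e]
    exact hc (Sum.inl μ)
  · obtain ⟨r, hr, hc⟩ := c.exists_hasCoef H hlam hp hG (Sum.inr i) (Sum.inr j)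
    have e := c.solve_inl hU hr hdet μ
    simp only [vec, Sum.elim_inl, Sum.elim_inr, c.koszul_f_f_e H.symm hG,
      koszul_f_f_f H.symm hG] at e
    rw [c.coefD_eq hh hdet, ← e]
    exact hc (Sum.inl μ)
  · obtain ⟨r, hr, hc⟩ := c.exists_hasCoef H hlam hp hG (Sum.inl α') (Sum.inl β')
    have e := c.solve_inr hU hr hdet k
    simp only [hΓ α' β' _ r hr] at e
    simp only [vec, Sum.elim_inl, Sum.elim_inr, c.koszul_e_e_f H.symm hG hp] at e
    rw [c.coefE_eq hg hh, ← e]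
    exact hc (Sum.inr k)

theorem hasCoefBH (hlam : lam ≠ 0) (hp : p ∈ c.domain)
    (hG : ∀ v w, frameForm α β v w = metricVal g A h v w)
    (hg : TensorProduct.comm (Smooth n M) _ _ g = g) (hh : h.IsSymm)
    (hg0 : (c.gMat g p).det ≠ 0) : c.HasCoefBH g A h p H.lcConnection := by
  have hU := c.det_blocks_ne_zero H hlam hp hG
  have hdet : (c.htLo g A h p).det ≠ 0 := by
    rw [c.htLo_eq]
    exact det_schur_ne_zero' hU hg0
  refine ⟨fun k α' i => ?_, fun k α' i => ?_, fun l i k => ?_⟩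
  · obtain ⟨r, hr, hc⟩ := c.exists_hasCoef H hlam hp hG (Sum.inl α') (Sum.inr i)
    have e := c.solve_inr' hU hr hg0 k
    simp only [vec, Sum.elim_inl, Sum.elim_inr, c.koszul_e_f_e H.symm hG hp,
      c.koszul_e_f_f H.symm hG] at e
    rw [c.coefB_eq hg hh, ← e]
    exact hc (Sum.inr k)
  · obtain ⟨r, hr, hc⟩ := c.exists_hasCoef H hlam hp hG (Sum.inr i) (Sum.inl α')
    have e := c.solve_inr' hU hr hg0 k
    simp only [vec, Sum.elim_inl, Sum.elim_inr, koszulForm_f_e, c.koszul_e_f_e H.symm hG hp,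
      c.koszul_e_f_f H.symm hG] at e
    rw [c.coefB_eq hg hh, ← e]
    exact hc (Sum.inr k)
  · obtain ⟨r, hr, hc⟩ := c.exists_hasCoef H hlam hp hG (Sum.inr i) (Sum.inr k)
    have e := c.solve_inr' hU hr hg0 l
    simp only [vec, Sum.elim_inl, Sum.elim_inr, c.koszul_f_f_e H.symm hG,
      koszul_f_f_f H.symm hG] at e
    rw [c.coefH_eq hg hh hdet, ← e]
    exact hc (Sum.inr l)

end LocalCoordinates

end

end QRG

end

/-! ### The theorem -/

open QRG in
theorem mainTheorem1 {n : ℕ} {M : Type*} [TopologicalSpace M]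
    [ChartedSpace (EuclideanSpace ℝ (Fin n)) M] [IsManifold (𝓡 n) ∞ M] [T2Space M]
    [SecondCountableTopology M] (lam : ℝ) (hlam₀ : lam ≠ 0) (hlam₁ : lam ^ 2 ≠ 1)
    (g : OneForm (Smooth n M) ⊗[Smooth n M] OneForm (Smooth n M))
    (hg : TensorProduct.comm (Smooth n M) _ _ g = g)
    (A : Fin 3 → OneForm (Smooth n M))
    (h : Matrix (Fin 3) (Fin 3) (Smooth n M)) (hh : h.IsSymm)
    (hmetric : IsQuantumMetric (prodWedge (Smooth n M) lam) (prodMetric lam g A h)) :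
    (∃! D : ProdConnection (Smooth n M) lam,
      D.IsQLC (prodWedge (Smooth n M) lam) (prodD₁ (Smooth n M) lam) (prodMetric lam g A h) ∧
        IsFlipOnBasis lam D) ∧
    ∀ D : ProdConnection (Smooth n M) lam,
      D.IsQLC (prodWedge (Smooth n M) lam) (prodD₁ (Smooth n M) lam) (prodMetric lam g A h) →
      IsFlipOnBasis lam D →
        IsStarPreserving lam D ∧
        (IsUnit h.det → ∀ (c : LocalCoordinates n M), ∀ p ∈ c.domain,
          (Matrix.of fun μ ν => c.gtLo g A h μ ν p).det ≠ 0 ∧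
          c.HasCoefΓFDE g A h p D ∧
          ((Matrix.of fun μ ν => c.gLo g μ ν p).det ≠ 0 →
            (c.htLo g A h p).det ≠ 0 ∧ c.HasCoefBH g A h p D)) := by

  obtain ⟨⟨P, hP⟩, -⟩ := hmetric
  obtain ⟨ι, _, α, β, h𝔤, hG⟩ := exists_frame lam g A h
  rw [h𝔤] at hP ⊢
  have H : IsMetricFrame lam α β P :=
    isMetricFrame_of_isMetricInverse
      (fun v w => by rw [hG, hG, metricVal_symm hg A hh]) hP
  refine ⟨⟨H.lcConnection, ⟨⟨H.lcConnection_isTorsionFree, H.lcConnection_isMetricCompatible⟩,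
    H.lcConnection_isFlipOnBasis⟩, fun D hD => H.eq_lcConnection hD.1 hD.2⟩, ?_⟩
  intro D hQ hF
  obtain rfl := H.eq_lcConnection hQ hF
  refine ⟨H.lcConnection_isStarPreserving, fun hdet c p hp => ?_⟩
  have hU := c.det_blocks_ne_zero H hlam₀ hp hG
  refine ⟨?_, c.hasCoefΓFDE H hlam₀ hp hG hg hh hdet, fun hg0 =>
    ⟨?_, c.hasCoefBH H hlam₀ hp hG hg hh hg0⟩⟩
  · rw [c.gtLo_eq hdet]
    exact det_schur_ne_zero hU (Smooth.det_apply_ne_zero hdet p)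
  · rw [c.htLo_eq]
    exact det_schur_ne_zero' hU hg0
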